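/- Let $\triangle=\{(x,y)\in\mathbb R^2: 0<y<x<1\}$. The triangle partition map $T=T_{e,23,e}$ is given as follows. Put $$V=\begin{pmatrix}1&1&1\\0&1&1\\0&0&1\end{pmatrix},\quad A_0=\begin{pmatrix}0&0&1\\1&0&0\\0&1&1\end{pmatrix},\quad A_1=\begin{pmatrix}1&0&1\\0&1&0\\0&0&1\end{pmatrix},\quad \pi(a,b,c)=\left(\tfrac ba,\tfrac ca\right),$$ and, for permutations $\sigma,\tau_0,\tau_1\in S_3$ (written as permutation matrices), $F_0=\sigma A_0\tau_0$, $F_1=\sigma A_1\tau_1$. Here $(\sigma,\tau_0,\tau_1)=(e,(23),e)$. For $k\ge 0$ let $\triangle_k$ be the open triangle whose vertices are the images under $\pi$ of the columns of $VF_1^kF_0$, and for $(x,y)\in\triangle_k$ let $$T(x,y)=\pi\left(V(F_1^kF_0)^{-1}V^{-1}(1,x,y)^{\mathsf T}\right)=\left(\frac yx,\ \frac{x+ky+y-1}{x}\right).$$ The expansion of $(x,y)$ is the sequence $(a_1,a_2,\dots)$ of non-negative integers with $T^{i-1}(x,y)\in\triangle_{a_i}$ for all $i\ge1$. We write $p(k)=c$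 if, for Lebesgue-almost every $(x,y)\in\triangle$, the expansion is defined and $$\lim_{n\to\infty}\frac{\#\{1\le i\le n: a_i=k\}}{n}=c .$$ Then $p(0)=\frac12$, and for every integer $k>0$ $$p(k)=\int_{\frac1{k+2}}^{\frac1{k+1}}\left(\int_{\frac{1-x}{k+1}}^{x}\frac{6}{\pi^2x(1-y)}\,dy\right)dx+\int_{\frac1{k+1}}^{1}\left(\int_{\frac{1-x}{k+1}}^{\frac{1-x}{k}}\frac{6}{\pi^2x(1-y)}\,dy\right)dx .$$ Moreover, for $k>0$, the function $\frac{6}{\pi^2x(1-y)}$ is integrable on $\triangle_k$, and the right-hand side equals $\iint_{\triangle_k}\frac{6}{\pi^2x(1-y)}\,dx\,dy$. -/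

import Mathlib

open MeasureTheory Filter Topology

namespace TRIP

noncomputable section

/-- The triangle `{(x, y) : 0 < y < x < 1}`. -/
def triangle : Set (ℝ × ℝ) := {p | 0 < p.2 ∧ p.2 < p.1 ∧ p.1 < 1}

/-- The columns of `V` are homogeneous coordinates of the vertices `(0,0)`, `(1,0)`, `(1,1)`
of the triangle. -/
def V : Matrix (Fin 3) (Fin 3) ℝ := !![1, 1, 1; 0, 1, 1; 0, 0, 1]

def A₀ : Matrix (Fin 3) (Fin 3) ℝ := !![0, 0, 1; 1, 0, 0; 0, 1, 1]

def A₁ : Matrix (Fin 3) (Fin 3) ℝ := !![1, 0, 1; 0, 1, 0; 0, 0, 1]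

/-- The matrix `F₀ = σ A₀ τ₀`; permutations act as permutation matrices, the letters `1, 2, 3` being
the indices `0, 1, 2` of `Fin 3`. -/
def F₀ (σ τ₀ : Equiv.Perm (Fin 3)) : Matrix (Fin 3) (Fin 3) ℝ :=
  σ.permMatrix ℝ * A₀ * τ₀.permMatrix ℝ

/-- The matrix `F₁ = σ A₁ τ₁`. -/
def F₁ (σ τ₁ : Equiv.Perm (Fin 3)) : Matrix (Fin 3) (Fin 3) ℝ :=
  σ.permMatrix ℝ * A₁ * τ₁.permMatrix ℝ

/-- The point `(1, x, y)` of space over the point `(x, y)` of the plane. -/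
def lift (p : ℝ × ℝ) : Fin 3 → ℝ := ![1, p.1, p.2]

/-- The projection `(a, b, c) ↦ (b / a, c / a)`. -/
def proj (w : Fin 3 → ℝ) : ℝ × ℝ := (w 1 / w 0, w 2 / w 0)

/-- The open subtriangle `△_k`, whose vertices are the projections of the columns of
`V F₁ ^ k F₀`: the points `(x, y)` for which `(1, x, y)` is a combination of these columns with
positive coefficients. -/
def cell (σ τ₀ τ₁ : Equiv.Perm (Fin 3)) (k : ℕ) : Set (ℝ × ℝ) :=
  {p | ∃ c : Fin 3 → ℝ, (∀ i, 0 < c i) ∧ (V * F₁ σ τ₁ ^ k * F₀ σ τ₀).mulVec c = lift p}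

/-- The projective map that carries `△_k` onto the triangle, taking the vertices of `△_k` in order
to `(0,0)`, `(1,0)`, `(1,1)`. -/
def branch (σ τ₀ τ₁ : Equiv.Perm (Fin 3)) (k : ℕ) (p : ℝ × ℝ) : ℝ × ℝ :=
  proj ((V * (F₁ σ τ₁ ^ k * F₀ σ τ₀)⁻¹ * V⁻¹).mulVec (lift p))

/-- The digit of a point: the `k` with `p ∈ △_k` (and `0` if there is none). -/
def digit (σ τ₀ τ₁ : Equiv.Perm (Fin 3)) (p : ℝ × ℝ) : ℕ :=
  sInf {k | p ∈ cell σ τ₀ τ₁ k}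

/-- The triangle partition map `T_{σ, τ₀, τ₁}`; only its values on the union of the subtriangles
are meaningful. -/
def T (σ τ₀ τ₁ : Equiv.Perm (Fin 3)) (p : ℝ × ℝ) : ℝ × ℝ :=
  branch σ τ₀ τ₁ (digit σ τ₀ τ₁ p) p

/-- The expansion of a point; `digits σ τ₀ τ₁ p i` is the digit `a_{i+1}`. -/
def digits (σ τ₀ τ₁ : Equiv.Perm (Fin 3)) (p : ℝ × ℝ) (i : ℕ) : ℕ :=
  digit σ τ₀ τ₁ ((T σ τ₀ τ₁)^[i] p)

/-- The point has an infinite expansion: every point of its orbit lies in a subtriangle. -/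
def HasExpansion (σ τ₀ τ₁ : Equiv.Perm (Fin 3)) (p : ℝ × ℝ) : Prop :=
  ∀ i : ℕ, (T σ τ₀ τ₁)^[i] p ∈ cell σ τ₀ τ₁ (digits σ τ₀ τ₁ p i)

/-- `P_{n,k}`, the proportion of the digits `a_1, …, a_n` that are equal to `k`. -/
def frequency (σ τ₀ τ₁ : Equiv.Perm (Fin 3)) (n k : ℕ) (p : ℝ × ℝ) : ℝ :=
  (((Finset.range n).filter fun i => digits σ τ₀ τ₁ p i = k).card : ℝ) / n

/-- Almost every point of the triangle, with respect to Lebesgue measure, has an infinite expansion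
in which the digit `k` has the limiting frequency `c`; in other words, `p(k) = c`. -/
def DigitFrequencyIs (σ τ₀ τ₁ : Equiv.Perm (Fin 3)) (k : ℕ) (c : ℝ) : Prop :=
  ∀ᵐ p ∂(volume.restrict triangle), HasExpansion σ τ₀ τ₁ p ∧
    Tendsto (fun n : ℕ => frequency σ τ₀ τ₁ n k p) atTop (𝓝 c)

end

end TRIP

open MeasureTheory Filter Topology

namespace TRIP

noncomputable section

/-! The map sends every `△_k` bijectively onto the whole triangle, and its inverse branches are
projective maps of matrices of determinant ±1, so their Jacobian is one over the cube of the
denominator. Two facts are needed: an invariant probability density, and ergodicity. Birkhoff's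
theorem for the indicator of `△_k` then gives the frequency as the mass of `△_k`, almost everywhere
for Lebesgue measure because the density is positive.

Invariance of 6/(π²x(1-y)) is a telescoping sum over the branches (`hasSum_invDensity_transfer`,
`measurePreserving_triMap`); its total mass is 1 because ζ(2) = π²/6 (`lintegral_invDensity`).

Ergodicity (`ergodic_triMap`) cannot rest on uniform distortion over the triangle, since the
denominators of the branches have unbounded ratios there. Instead one cylinder lying compactly
inside the triangle, `coreTriangle`, is used. On it denominators of all inverse branches vary by at
most a factor 9, and each passage through it contracts by 72/73. By Poincaré recurrence almost every
point of the core returns infinitely often, so cylinders ending in the core word shrink to it;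
bounded distortion on them forces an invariant set that meets the core in positive measure to fill
the core (`volume_coreTriangle_diff_eq_zero`), and an invariant set null in the core is null in the
triangle.

The value 1/2 for the digit 0 comes from the symmetry (x, y) ↦ (1-y, 1-x) of the density. -/

/-- The subtriangle `△_k` of the map `T_{e,23,e}`. -/
abbrev subtriangle (k : ℕ) : Set (ℝ × ℝ) := cell 1 (Equiv.swap 1 2) 1 k

/-- The triangle partition map `T_{e,23,e}`. -/
abbrev triMap : ℝ × ℝ → ℝ × ℝ := T 1 (Equiv.swap 1 2) 1

/-- The first digit of a point with respect to `T_{e,23,e}`. -/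
abbrev firstDigit : ℝ × ℝ → ℕ := digit 1 (Equiv.swap 1 2) 1

/-! ### Explicit form of the cells and of the map. -/

lemma F₁_one_pow (k : ℕ) : F₁ 1 1 ^ k = !![1, 0, (k : ℝ); 0, 1, 0; 0, 0, 1] := by
  have h : F₁ 1 1 = !![1, 0, 1; 0, 1, 0; 0, 0, 1] := by
    simp [F₁, A₁, Equiv.Perm.permMatrix]
  induction k with
  | zero => ext i j; fin_cases i <;> fin_cases j <;> simp
  | succ k ih =>
    rw [pow_succ, ih, h]
    ext i j; fin_cases i <;> fin_cases j <;> simp [Matrix.mul_apply, Fin.sum_univ_three, add_comm]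

lemma F₀_swap : F₀ 1 (Equiv.swap 1 2) = !![0, 1, 0; 1, 0, 0; 0, 1, 1] := by
  ext i j
  fin_cases i <;> fin_cases j <;>
    simp [F₀, A₀, Matrix.mul_apply, Fin.sum_univ_three, Equiv.Perm.permMatrix, PEquiv.toMatrix,
      Equiv.swap_apply_def]

lemma F₁_pow_mul_F₀ (k : ℕ) : F₁ 1 1 ^ k * F₀ 1 (Equiv.swap 1 2) =
    !![0, (k : ℝ) + 1, k; 1, 0, 0; 0, 1, 1] := by
  rw [F₁_one_pow, F₀_swap]
  ext i j
  fin_cases i <;> fin_cases j <;> simp [Matrix.mul_apply, Fin.sum_univ_three, add_comm]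

lemma mem_subtriangle {k : ℕ} {p : ℝ × ℝ} : p ∈ subtriangle k ↔
    p.2 < p.1 ∧ p.1 + k * p.2 < 1 ∧ 1 < p.1 + (k + 1) * p.2 := by
  have key : V * F₁ 1 1 ^ k * F₀ 1 (Equiv.swap 1 2) =
      !![1, (k : ℝ) + 2, k + 1; 1, 1, 1; 0, 1, 1] := by
    rw [mul_assoc, F₁_pow_mul_F₀]
    ext i j
    fin_cases i <;> fin_cases j <;> (simp [V, Matrix.mul_apply, Fin.sum_univ_three]; try ring)
  simp only [subtriangle, cell, Set.mem_ofPred_eq, key]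
  constructor
  · rintro ⟨c, hc, h⟩
    have h0 := congrFun h 0
    have h1 := congrFun h 1
    have h2 := congrFun h 2
    simp [Matrix.mulVec, dotProduct, Fin.sum_univ_three, lift] at h0 h1 h2
    have c0 := hc 0
    have c1 := hc 1
    have c2 := hc 2
    rw [← h1, ← h2]
    refine ⟨by linarith, by linarith, by linarith⟩
  · rintro ⟨h1, h2, h3⟩
    -- The coordinates of `lift p` in the basis of the columns in `key`; their positivity is exactly
    -- the three inequalities.
    refine ⟨![p.1 - p.2, 1 - p.1 - k * p.2, p.1 + (k + 1) * p.2 - 1], ?_, ?_⟩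
    · intro i; fin_cases i <;> simp <;> linarith
    · ext i
      fin_cases i <;> simp [Matrix.mulVec, dotProduct, Fin.sum_univ_three, lift] <;> ring

lemma subtriangle_pos {k : ℕ} {p : ℝ × ℝ} (hp : p ∈ subtriangle k) : 0 < p.2 := by
  rw [mem_subtriangle] at hp
  linarith [hp.2.1, hp.2.2]

lemma subtriangle_subset_triangle (k : ℕ) : subtriangle k ⊆ triangle := by
  intro p hp
  have h := subtriangle_pos hp
  rw [mem_subtriangle] at hp
  refine ⟨h, hp.1, ?_⟩
  have : 0 ≤ (k : ℝ) * p.2 := by positivity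
  linarith [hp.2.1]

lemma branch_eq (k : ℕ) (p : ℝ × ℝ) : branch 1 (Equiv.swap 1 2) 1 k p =
    (p.2 / p.1, (p.1 + (k + 1) * p.2 - 1) / p.1) := by
  have hV : V⁻¹ = !![1, -1, 0; 0, 1, -1; 0, 0, 1] := by
    apply Matrix.inv_eq_left_inv
    ext i j
    fin_cases i <;> fin_cases j <;> simp [V, Matrix.mul_apply, Fin.sum_univ_three]
  have hF : (F₁ 1 1 ^ k * F₀ 1 (Equiv.swap 1 2))⁻¹ =
      !![0, 1, 0; 1, 0, -(k : ℝ); -1, 0, k + 1] := by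
    apply Matrix.inv_eq_left_inv
    rw [F₁_pow_mul_F₀]
    ext i j
    fin_cases i <;> fin_cases j <;> simp [Matrix.mul_apply, Fin.sum_univ_three]
  have key : V * (F₁ 1 1 ^ k * F₀ 1 (Equiv.swap 1 2))⁻¹ * V⁻¹ =
      !![0, 1, 0; 0, 0, 1; -1, 1, (k : ℝ) + 1] := by
    rw [hV, hF]
    ext i j
    fin_cases i <;> fin_cases j <;> simp [V, Matrix.mul_apply, Fin.sum_univ_three]
  rw [branch, key]
  simp [proj, lift, Matrix.mulVec, dotProduct, Fin.sum_univ_three]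
  ring

lemma subtriangle_index_unique {k l : ℕ} {p : ℝ × ℝ} (hk : p ∈ subtriangle k)
    (hl : p ∈ subtriangle l) : k = l := by
  have h := subtriangle_pos hk
  rw [mem_subtriangle] at hk hl
  have h1 : (k : ℝ) < l + 1 := lt_of_mul_lt_mul_right (by linarith [hk.2.1, hl.2.2]) h.le
  have h2 : (l : ℝ) < k + 1 := lt_of_mul_lt_mul_right (by linarith [hk.2.2, hl.2.1]) h.le
  norm_cast at h1 h2
  omega

lemma firstDigit_eq {k : ℕ} {p : ℝ × ℝ} (hk : p ∈ subtriangle k) : firstDigit p = k := by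
  have : {l | p ∈ subtriangle l} = {k} := by
    ext l
    exact ⟨fun hl => subtriangle_index_unique hl hk, fun hl => by rw [hl]; exact hk⟩
  simp only [firstDigit, digit]
  rw [this, csInf_singleton]

lemma triMap_eq {k : ℕ} {p : ℝ × ℝ} (hk : p ∈ subtriangle k) :
    triMap p = (p.2 / p.1, (p.1 + (k + 1) * p.2 - 1) / p.1) := by
  simp only [triMap, T]
  rw [show digit 1 (Equiv.swap 1 2) 1 p = k from firstDigit_eq hk, branch_eq]

lemma triMap_mem_triangle {k : ℕ} {p : ℝ × ℝ} (hk : p ∈ subtriangle k) :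
    triMap p ∈ triangle := by
  have h := subtriangle_pos hk
  rw [triMap_eq hk]
  rw [mem_subtriangle] at hk
  have hx : 0 < p.1 := h.trans hk.1
  refine ⟨?_, ?_, ?_⟩
  · exact div_pos (by linarith [hk.2.2]) hx
  · exact div_lt_div_of_pos_right (by linarith [hk.2.1]) hx
  · exact (div_lt_one hx).2 hk.1

/-! ### Projective maps of unimodular matrices: composition, Jacobian, change of variables. -/

/-- The denominator of the projective map of a matrix. -/
def denom (M : Matrix (Fin 3) (Fin 3) ℝ) (p : ℝ × ℝ) : ℝ := M 0 0 + M 0 1 * p.1 + M 0 2 * p.2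

/-- The projective map of a matrix, in the affine chart `(x, y) ↦ (1, x, y)`. -/
def projMap (M : Matrix (Fin 3) (Fin 3) ℝ) (p : ℝ × ℝ) : ℝ × ℝ :=
  ((M 1 0 + M 1 1 * p.1 + M 1 2 * p.2) / denom M p,
    (M 2 0 + M 2 1 * p.1 + M 2 2 * p.2) / denom M p)

/-- A unimodular matrix that maps the cone `0 < c < b < a` over the triangle into itself. -/
structure IsTriangleMatrix (M : Matrix (Fin 3) (Fin 3) ℝ) : Prop where
  abs_det : |M.det| = 1
  cone : ∀ a b c : ℝ, 0 < c → c < b → b < a →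
    0 < M 2 0 * a + M 2 1 * b + M 2 2 * c ∧
    M 2 0 * a + M 2 1 * b + M 2 2 * c < M 1 0 * a + M 1 1 * b + M 1 2 * c ∧
    M 1 0 * a + M 1 1 * b + M 1 2 * c < M 0 0 * a + M 0 1 * b + M 0 2 * c

lemma isTriangleMatrix_one : IsTriangleMatrix 1 where
  abs_det := by simp
  cone a b c h1 h2 h3 := by simp [h1, h2, h3]

lemma IsTriangleMatrix.mul {M N : Matrix (Fin 3) (Fin 3) ℝ} (hM : IsTriangleMatrix M)
    (hN : IsTriangleMatrix N) : IsTriangleMatrix (M * N) where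
  abs_det := by rw [Matrix.det_mul, abs_mul, hM.abs_det, hN.abs_det, one_mul]
  cone a b c h1 h2 h3 := by
    obtain ⟨k1, k2, k3⟩ := hN.cone a b c h1 h2 h3
    obtain ⟨l1, l2, l3⟩ := hM.cone _ _ _ k1 k2 k3
    simp only [Matrix.mul_apply, Fin.sum_univ_three]
    refine ⟨?_, ?_, ?_⟩ <;> linarith

lemma IsTriangleMatrix.denom_pos {M : Matrix (Fin 3) (Fin 3) ℝ} (hM : IsTriangleMatrix M)
    {p : ℝ × ℝ} (hp : p ∈ triangle) : 0 < denom M p := by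
  obtain ⟨h1, h2, h3⟩ := hM.cone 1 p.1 p.2 hp.1 hp.2.1 hp.2.2
  rw [denom]
  linarith

lemma IsTriangleMatrix.mapsTo {M : Matrix (Fin 3) (Fin 3) ℝ} (hM : IsTriangleMatrix M) :
    Set.MapsTo (projMap M) triangle triangle := by
  intro p hp
  have h := hM.denom_pos hp
  obtain ⟨h1, h2, h3⟩ := hM.cone 1 p.1 p.2 hp.1 hp.2.1 hp.2.2
  simp only [mul_one] at h1 h2 h3
  refine ⟨div_pos h1 h, div_lt_div_of_pos_right h2 h, (div_lt_one h).2 h3⟩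

lemma denom_mul {M N : Matrix (Fin 3) (Fin 3) ℝ} {p : ℝ × ℝ} (hN : denom N p ≠ 0) :
    denom (M * N) p = denom M (projMap N p) * denom N p := by
  simp only [denom, projMap, Matrix.mul_apply, Fin.sum_univ_three] at *
  field_simp
  ring

lemma projMap_mul {M N : Matrix (Fin 3) (Fin 3) ℝ} (hM : IsTriangleMatrix M)
    (hN : IsTriangleMatrix N) {p : ℝ × ℝ} (hp : p ∈ triangle) :
    projMap (M * N) p = projMap M (projMap N p) := by
  have h1 := (hN.denom_pos hp).ne'
  have h2 := (hM.denom_pos (hN.mapsTo hp)).ne'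
  have h3 := denom_mul (M := M) h1
  rw [projMap, h3]
  generalize hd : denom M (projMap N p) = d at *
  rw [projMap, hd]
  simp only [projMap, Matrix.mul_apply, Fin.sum_univ_three, Prod.mk.injEq]
  constructor <;> (field_simp; simp only [denom]; ring)

lemma projMap_one (p : ℝ × ℝ) : projMap 1 p = p := by
  simp [projMap, denom]

lemma isOpen_triangle : IsOpen triangle := by
  have h1 : IsOpen {p : ℝ × ℝ | 0 < p.2} := isOpen_lt continuous_const continuous_snd
  have h2 : IsOpen {p : ℝ × ℝ | p.2 < p.1} := isOpen_lt continuous_snd continuous_fst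
  have h3 : IsOpen {p : ℝ × ℝ | p.1 < 1} := isOpen_lt continuous_fst continuous_const
  exact h1.inter (h2.inter h3)

lemma measurableSet_triangle : MeasurableSet triangle := isOpen_triangle.measurableSet

/-- The derivative of a projective map. -/
def fderivProjMap (M : Matrix (Fin 3) (Fin 3) ℝ) (p : ℝ × ℝ) : ℝ × ℝ →L[ℝ] ℝ × ℝ :=
  (Matrix.toLin (Module.Basis.finTwoProd ℝ) (Module.Basis.finTwoProd ℝ)
    !![(M 1 1 * denom M p - (M 1 0 + M 1 1 * p.1 + M 1 2 * p.2) * M 0 1) / denom M p ^ 2,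
       (M 1 2 * denom M p - (M 1 0 + M 1 1 * p.1 + M 1 2 * p.2) * M 0 2) / denom M p ^ 2;
       (M 2 1 * denom M p - (M 2 0 + M 2 1 * p.1 + M 2 2 * p.2) * M 0 1) / denom M p ^ 2,
       (M 2 2 * denom M p - (M 2 0 + M 2 1 * p.1 + M 2 2 * p.2) * M 0 2) / denom M p ^ 2]
    ).toContinuousLinearMap

lemma hasFDerivAt_affine (a b c : ℝ) (p : ℝ × ℝ) :
    HasFDerivAt (fun q : ℝ × ℝ => a + b * q.1 + c * q.2)
      (b • ContinuousLinearMap.fst ℝ ℝ ℝ + c • ContinuousLinearMap.snd ℝ ℝ ℝ) p :=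
  ((hasFDerivAt_fst.const_mul b).const_add a).add (hasFDerivAt_snd.const_mul c)

lemma hasFDerivAt_projMap {M : Matrix (Fin 3) (Fin 3) ℝ} {p : ℝ × ℝ} (h : denom M p ≠ 0) :
    HasFDerivAt (projMap M) (fderivProjMap M p) p := by
  have hd := hasFDerivAt_affine (M 0 0) (M 0 1) (M 0 2) p
  have hi := (hasDerivAt_inv h).comp_hasFDerivAt p hd
  have h1 := (hasFDerivAt_affine (M 1 0) (M 1 1) (M 1 2) p).mul hi
  have h2 := (hasFDerivAt_affine (M 2 0) (M 2 1) (M 2 2) p).mul hi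
  refine (h1.prodMk h2).congr_fderiv ?_
  rw [fderivProjMap, Matrix.toLin_finTwoProd_toContinuousLinearMap]
  ext <;> simp <;> field_simp <;> ring

lemma det_fderivProjMap {M : Matrix (Fin 3) (Fin 3) ℝ} {p : ℝ × ℝ} (h : denom M p ≠ 0) :
    (fderivProjMap M p).det = M.det / denom M p ^ 3 := by
  unfold fderivProjMap
  simp only [LinearMap.det_toContinuousLinearMap, LinearMap.det_toLin, Matrix.det_fin_two_of]
  rw [Matrix.det_fin_three]
  field_simp
  simp only [denom]
  ring

lemma injOn_projMap {M : Matrix (Fin 3) (Fin 3) ℝ} (hM : IsTriangleMatrix M) :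
    Set.InjOn (projMap M) triangle := by
  intro p hp q hq h
  have hdet : IsUnit M.det := by
    rw [isUnit_iff_ne_zero]
    intro h0
    have := hM.abs_det
    simp [h0] at this
  have h1 := (hM.denom_pos hp).ne'
  have h2 := (hM.denom_pos hq).ne'
  simp only [projMap, Prod.mk.injEq] at h
  obtain ⟨e1, e2⟩ := h
  -- Equal projective images become equal vectors after cross-multiplying the denominators, so
  -- invertibility of `M` applies.
  have key : M.mulVec (denom M q • lift p) = M.mulVec (denom M p • lift q) := by
    rw [div_eq_div_iff h1 h2] at e1 e2
    ext i
    fin_cases i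
    · simp [Matrix.mulVec, dotProduct, Fin.sum_univ_three, lift, denom]; ring
    · simp [Matrix.mulVec, dotProduct, Fin.sum_univ_three, lift]; linarith
    · simp [Matrix.mulVec, dotProduct, Fin.sum_univ_three, lift]; linarith
  have key2 := Matrix.mulVec_injective_of_isUnit ((Matrix.isUnit_iff_isUnit_det M).2 hdet) key
  have c0 := congrFun key2 0
  have c1 := congrFun key2 1
  have c2 := congrFun key2 2
  simp [lift] at c0 c1 c2
  rw [c0] at c1 c2
  ext
  · exact mul_left_cancel₀ h1 c1
  · exact mul_left_cancel₀ h1 c2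

lemma lintegral_image_projMap {M : Matrix (Fin 3) (Fin 3) ℝ} (hM : IsTriangleMatrix M)
    {s : Set (ℝ × ℝ)} (hs : MeasurableSet s) (hst : s ⊆ triangle) (g : ℝ × ℝ → ENNReal) :
    ∫⁻ p in projMap M '' s, g p =
      ∫⁻ p in s, ENNReal.ofReal (1 / denom M p ^ 3) * g (projMap M p) := by
  rw [lintegral_image_eq_lintegral_abs_det_fderiv_mul volume hs
    (fun _ hp => (hasFDerivAt_projMap (hM.denom_pos (hst hp)).ne').hasFDerivWithinAt)
    ((injOn_projMap hM).mono hst)]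
  refine setLIntegral_congr_fun hs fun p hp => ?_
  have h := hM.denom_pos (hst hp)
  simp only [det_fderivProjMap h.ne', abs_div, hM.abs_det, abs_of_pos (pow_pos h 3)]

lemma volume_image_projMap {M : Matrix (Fin 3) (Fin 3) ℝ} (hM : IsTriangleMatrix M)
    {s : Set (ℝ × ℝ)} (hs : MeasurableSet s) (hst : s ⊆ triangle) :
    volume (projMap M '' s) = ∫⁻ p in s, ENNReal.ofReal (1 / denom M p ^ 3) := by
  rw [← setLIntegral_one, lintegral_image_projMap hM hs hst]
  simp

lemma measurableSet_image_projMap {M : Matrix (Fin 3) (Fin 3) ℝ} (hM : IsTriangleMatrix M)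
    {s : Set (ℝ × ℝ)} (hs : MeasurableSet s) (hst : s ⊆ triangle) :
    MeasurableSet (projMap M '' s) :=
  measurable_image_of_fderivWithin hs
    (fun _ hp => (hasFDerivAt_projMap (hM.denom_pos (hst hp)).ne').hasFDerivWithinAt)
    ((injOn_projMap hM).mono hst)

/-! ### Inverse branches, measurability, and the cells filling the triangle up to a null set. -/

/-- The matrix of the inverse branch of `T_{e,23,e}` onto `△_k`. -/
def branchMatrix (k : ℕ) : Matrix (Fin 3) (Fin 3) ℝ := !![1, (k : ℝ) + 1, -1; 1, 0, 0; 0, 1, 0]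

lemma isTriangleMatrix_branchMatrix (k : ℕ) : IsTriangleMatrix (branchMatrix k) where
  abs_det := by simp [branchMatrix, Matrix.det_fin_three]
  cone a b c h1 h2 h3 := by
    have : 0 ≤ (k : ℝ) * b := by have := h1.trans h2; positivity
    simp [branchMatrix]
    refine ⟨?_, ?_, ?_⟩ <;> linarith

lemma denom_branchMatrix (k : ℕ) (p : ℝ × ℝ) :
    denom (branchMatrix k) p = 1 + (k + 1) * p.1 - p.2 := by
  simp [denom, branchMatrix]
  ring

lemma projMap_branchMatrix (k : ℕ) (p : ℝ × ℝ) : projMap (branchMatrix k) p =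
    (1 / (1 + (k + 1) * p.1 - p.2), p.1 / (1 + (k + 1) * p.1 - p.2)) := by
  rw [projMap, denom_branchMatrix]
  simp [branchMatrix]

lemma projMap_branchMatrix_mem {k : ℕ} {p : ℝ × ℝ} (hp : p ∈ triangle) :
    projMap (branchMatrix k) p ∈ subtriangle k := by
  have h := (isTriangleMatrix_branchMatrix k).denom_pos hp
  rw [denom_branchMatrix] at h
  obtain ⟨h1, h2, h3⟩ := hp
  rw [mem_subtriangle, projMap_branchMatrix]
  refine ⟨div_lt_div_of_pos_right h3 h, ?_, ?_⟩
  · rw [← mul_div_assoc, ← add_div, div_lt_one h]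
    linarith
  · rw [← mul_div_assoc, ← add_div, one_lt_div h]
    linarith

lemma triMap_projMap_branchMatrix (k : ℕ) {p : ℝ × ℝ} (hp : p ∈ triangle) :
    triMap (projMap (branchMatrix k) p) = p := by
  have h := (isTriangleMatrix_branchMatrix k).denom_pos hp
  rw [denom_branchMatrix] at h
  rw [triMap_eq (projMap_branchMatrix_mem hp), projMap_branchMatrix]
  have := h.ne'
  have h' : 1 + p.1 * (k + 1) - p.2 ≠ 0 := by rwa [mul_comm p.1]
  ext
  · simp only; field_simp
  · simp only; field_simp; ring

lemma projMap_branchMatrix_triMap {k : ℕ} {p : ℝ × ℝ} (hp : p ∈ subtriangle k) :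
    projMap (branchMatrix k) (triMap p) = p := by
  have h := subtriangle_pos hp
  rw [projMap_branchMatrix, triMap_eq hp]
  rw [mem_subtriangle] at hp
  have hx : p.1 ≠ 0 := (h.trans hp.1).ne'
  have : 1 + (k + 1) * (p.2 / p.1) - (p.1 + (k + 1) * p.2 - 1) / p.1 = 1 / p.1 := by
    field_simp; ring
  simp only [this]
  ext <;> simp
  field_simp

lemma measurableSet_subtriangle (k : ℕ) : MeasurableSet (subtriangle k) := by
  have : subtriangle k = {p : ℝ × ℝ | p.2 < p.1} ∩ ({p | p.1 + k * p.2 < 1} ∩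
      {p | 1 < p.1 + (k + 1) * p.2}) := by
    ext p; exact mem_subtriangle
  rw [this]
  exact (measurableSet_lt (by fun_prop) (by fun_prop)).inter
    ((measurableSet_lt (by fun_prop) (by fun_prop)).inter
      (measurableSet_lt (by fun_prop) (by fun_prop)))

lemma firstDigit_eq_zero {p : ℝ × ℝ} (hp : ∀ k, p ∉ subtriangle k) : firstDigit p = 0 := by
  have : {l | p ∈ subtriangle l} = ∅ := by
    ext l; simpa using hp l
  simp only [firstDigit, digit]
  rw [this, Nat.sInf_empty]

lemma measurable_firstDigit : Measurable firstDigit := by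
  refine measurable_to_countable' fun k => ?_
  have hU : MeasurableSet (⋃ k, subtriangle k) := MeasurableSet.iUnion measurableSet_subtriangle
  rcases Nat.eq_zero_or_pos k with rfl | hk
  -- Points in no cell have digit `sInf ∅ = 0`, so the fibre over 0 also contains the complement of
  -- all cells.
  · convert (measurableSet_subtriangle 0).union hU.compl using 1
    ext p
    simp only [Set.mem_preimage, Set.mem_singleton_iff, Set.mem_union, Set.mem_compl_iff,
      Set.mem_iUnion, not_exists]
    constructor
    · intro h
      by_contra! hcon
      obtain ⟨h0, l, hl⟩ := hcon
      rw [firstDigit_eq hl] at h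
      exact h0 (h ▸ hl)
    · rintro (h | h)
      · exact firstDigit_eq h
      · exact firstDigit_eq_zero h
  · convert measurableSet_subtriangle k using 1
    ext p
    simp only [Set.mem_preimage, Set.mem_singleton_iff]
    constructor
    · intro h
      by_contra hcon
      by_cases hl : ∃ l, p ∈ subtriangle l
      · obtain ⟨l, hl⟩ := hl
        rw [firstDigit_eq hl] at h
        exact hcon (h ▸ hl)
      · push Not at hl
        rw [firstDigit_eq_zero hl] at h
        omega
    · exact firstDigit_eq

lemma measurable_triMap : Measurable triMap := by
  have h : triMap = fun p => (p.2 / p.1, (p.1 + ((firstDigit p : ℝ) + 1) * p.2 - 1) / p.1) := by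
    funext p
    exact branch_eq _ _
  have hd : Measurable fun p => (firstDigit p : ℝ) := measurable_from_nat.comp measurable_firstDigit
  rw [h]
  fun_prop

lemma exists_mem_subtriangle_or {p : ℝ × ℝ} (hp : p ∈ triangle) :
    (∃ k, p ∈ subtriangle k) ∨ ∃ k : ℕ, p.2 = (1 - p.1) / (k + 1) := by
  obtain ⟨h1, h2, h3⟩ := hp
  have h0 : 0 ≤ (1 - p.1) / p.2 := by
    have : 0 < 1 - p.1 := by linarith
    positivity
  have hlt := Nat.lt_floor_add_one ((1 - p.1) / p.2)
  have hle := Nat.floor_le h0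
  -- The digit is the integer part of (1-x)/y; when this quotient is an integer, the point lies on a
  -- side shared by two consecutive cells.
  set k := ⌊(1 - p.1) / p.2⌋₊
  rw [div_lt_iff₀ h1] at hlt
  rw [le_div_iff₀ h1] at hle
  rcases hle.lt_or_eq with hl | he
  · exact Or.inl ⟨k, mem_subtriangle.2 ⟨h2, by linarith, by linarith⟩⟩
  · right
    have hk : k ≠ 0 := by
      intro h
      rw [h] at he
      simp at he
      linarith
    obtain ⟨m, hm⟩ := Nat.exists_eq_succ_of_ne_zero hk
    refine ⟨m, ?_⟩
    rw [hm] at he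
    push_cast at he
    have : (m : ℝ) + 1 ≠ 0 := by positivity
    field_simp
    linarith

lemma volume_graph_eq_zero {f : ℝ → ℝ} (hf : Measurable f) :
    volume {p : ℝ × ℝ | p.2 = f p.1} = 0 := by
  have hs : MeasurableSet {p : ℝ × ℝ | p.2 = f p.1} :=
    measurableSet_eq_fun measurable_snd (hf.comp measurable_fst)
  rw [Measure.volume_eq_prod, Measure.measure_prod_null hs]
  refine Eventually.of_forall fun x => ?_
  have : Prod.mk x ⁻¹' {p : ℝ × ℝ | p.2 = f p.1} = {f x} := by ext y; simp
  change volume (Prod.mk x ⁻¹' {p : ℝ × ℝ | p.2 = f p.1}) = 0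
  rw [this]
  simp

lemma ae_mem_subtriangle :
    ∀ᵐ p : ℝ × ℝ, p ∈ triangle → ∃ k, p ∈ subtriangle k := by
  have h : ∀ᵐ p : ℝ × ℝ, ∀ k : ℕ, ¬ p.2 = (1 - p.1) / (k + 1) := by
    rw [ae_all_iff]
    intro k
    have := volume_graph_eq_zero (f := fun x => (1 - x) / ((k : ℝ) + 1)) (by fun_prop)
    rw [ae_iff]
    simpa using this
  filter_upwards [h] with p hp hpt
  rcases exists_mem_subtriangle_or hpt with h | ⟨k, hk⟩
  · exact h
  · exact absurd hk (hp k)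

/-! ### The invariant density. -/

/-- The density of the invariant probability measure of `T_{e,23,e}`. -/
def invDensity (p : ℝ × ℝ) : ℝ := 6 / (Real.pi ^ 2 * p.1 * (1 - p.2))

lemma measurable_invDensity : Measurable invDensity := by unfold invDensity; fun_prop

lemma invDensity_pos {p : ℝ × ℝ} (hp : p ∈ triangle) : 0 < invDensity p := by
  obtain ⟨h1, h2, h3⟩ := hp
  have h4 : 0 < p.1 := h1.trans h2
  have h5 : 0 < 1 - p.2 := by linarith
  unfold invDensity
  positivity

/-- The Perron–Frobenius equation. One factor 1+(k+1)x-y of the cubed denominator survives and 1-y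
turns into a ratio of consecutive denominators, so the k-th term is a difference of consecutive
values of 6/(π²x(1+kx-y)), and the sum telescopes. -/
lemma hasSum_invDensity_transfer {p : ℝ × ℝ} (hp : p ∈ triangle) :
    HasSum (fun k : ℕ => 1 / denom (branchMatrix k) p ^ 3 *
      invDensity (projMap (branchMatrix k) p)) (invDensity p) := by
  obtain ⟨h1, h2, h3⟩ := hp
  have hx : 0 < p.1 := h1.trans h2
  set f : ℕ → ℝ := fun k => 6 / (Real.pi ^ 2 * p.1) * (1 / (1 + k * p.1 - p.2)) with hf
  have hpos : ∀ k : ℕ, 0 < 1 + k * p.1 - p.2 := fun k => by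
    have : 0 ≤ k * p.1 := by positivity
    linarith
  have hterm : ∀ k : ℕ, 1 / denom (branchMatrix k) p ^ 3 *
      invDensity (projMap (branchMatrix k) p) = f k - f (k + 1) := by
    intro k
    have e1 := hpos k
    have e2 := hpos (k + 1)
    push_cast at e2
    rw [denom_branchMatrix, projMap_branchMatrix, invDensity]
    simp only [hf]
    push_cast
    have e3 : 1 - p.1 / (1 + (k + 1) * p.1 - p.2) =
        (1 + k * p.1 - p.2) / (1 + (k + 1) * p.1 - p.2) := by
      rw [eq_div_iff e2.ne', sub_mul, div_mul_cancel₀ _ e2.ne']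
      ring
    rw [e3]
    have := Real.pi_pos
    field_simp
    ring
  have hlim : Tendsto f atTop (𝓝 0) := by
    have h : Tendsto (fun k : ℕ => 1 + (k : ℝ) * p.1 - p.2) atTop atTop :=
      tendsto_atTop_add_const_right _ _ (tendsto_atTop_add_const_left _ _
        (tendsto_natCast_atTop_atTop.atTop_mul_const hx))
    have := (h.inv_tendsto_atTop).const_mul (6 / (Real.pi ^ 2 * p.1))
    simpa [hf] using this
  rw [hasSum_iff_tendsto_nat_of_nonneg]
  · have hsum : ∀ n : ℕ, ∑ k ∈ Finset.range n, 1 / denom (branchMatrix k) p ^ 3 *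
        invDensity (projMap (branchMatrix k) p) = f 0 - f n := fun n => by
      simp_rw [hterm]
      exact Finset.sum_range_sub' f n
    simp_rw [hsum]
    have h0 : f 0 = invDensity p := by
      have : 1 - p.2 ≠ 0 := by linarith
      simp only [hf, invDensity]
      rw [show 1 + ((0 : ℕ) : ℝ) * p.1 - p.2 = 1 - p.2 by simp]
      field_simp
    simpa [h0] using hlim.const_sub (f 0)
  · intro k
    have hp' : p ∈ triangle := ⟨h1, h2, h3⟩
    have e := (isTriangleMatrix_branchMatrix k).denom_pos hp'
    have := invDensity_pos ((isTriangleMatrix_branchMatrix k).mapsTo hp')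
    positivity

/-- The invariant measure of `T_{e,23,e}` that is equivalent to Lebesgue measure. -/
def invMeasure : Measure (ℝ × ℝ) :=
  (volume.restrict triangle).withDensity fun p => ENNReal.ofReal (invDensity p)

lemma invMeasure_apply {s : Set (ℝ × ℝ)} (hs : MeasurableSet s) :
    invMeasure s = ∫⁻ p in s ∩ triangle, ENNReal.ofReal (invDensity p) := by
  rw [invMeasure, withDensity_apply _ hs, Measure.restrict_restrict hs]

lemma measurable_ofReal_invDensity : Measurable fun p => ENNReal.ofReal (invDensity p) :=
  measurable_invDensity.ennreal_ofReal

lemma ae_invMeasure_iff {P : ℝ × ℝ → Prop} :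
    (∀ᵐ p ∂invMeasure, P p) ↔ ∀ᵐ p ∂(volume.restrict triangle), P p := by
  rw [invMeasure, ae_withDensity_iff measurable_ofReal_invDensity,
    ae_restrict_iff' measurableSet_triangle, ae_restrict_iff' measurableSet_triangle]
  refine eventually_congr (Eventually.of_forall fun p => ?_)
  constructor
  · intro h hp
    exact h hp (by simpa using invDensity_pos hp)
  · intro h hp _
    exact h hp

lemma preimage_inter_subtriangle (k : ℕ) (s : Set (ℝ × ℝ)) :
    triMap ⁻¹' s ∩ subtriangle k = projMap (branchMatrix k) '' (s ∩ triangle) := by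
  ext p
  constructor
  · rintro ⟨h1, h2⟩
    exact ⟨triMap p, ⟨h1, triMap_mem_triangle h2⟩, projMap_branchMatrix_triMap h2⟩
  · rintro ⟨q, ⟨h1, h2⟩, rfl⟩
    refine ⟨?_, projMap_branchMatrix_mem h2⟩
    rw [Set.mem_preimage, triMap_projMap_branchMatrix k h2]
    exact h1

lemma pairwise_disjoint_subtriangle : Pairwise (Function.onFun Disjoint subtriangle) := by
  intro k l hkl
  rw [Function.onFun, Set.disjoint_left]
  exact fun p hk hl => hkl (subtriangle_index_unique hk hl)

/-- Up to a null set the preimage of `s` is the disjoint union of the images of `s` under the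
inverse branches; a change of variables on each one reduces the claim to the transfer equation. -/
lemma measurePreserving_triMap : MeasurePreserving triMap invMeasure invMeasure := by
  refine ⟨measurable_triMap, ?_⟩
  ext s hs
  rw [Measure.map_apply measurable_triMap hs, invMeasure_apply (measurable_triMap hs),
    invMeasure_apply hs]
  have hae : (triMap ⁻¹' s ∩ triangle : Set (ℝ × ℝ)) =ᵐ[volume]
      ⋃ k, triMap ⁻¹' s ∩ subtriangle k := by
    rw [← Set.inter_iUnion]
    filter_upwards [ae_mem_subtriangle] with p hp
    apply propext
    refine and_congr_right fun _ => ?_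
    constructor
    · intro h; exact Set.mem_iUnion.2 (hp h)
    · intro h
      obtain ⟨k, hk⟩ := Set.mem_iUnion.1 h
      exact subtriangle_subset_triangle k hk
  rw [setLIntegral_congr hae, lintegral_iUnion
    (fun k => (measurable_triMap hs).inter (measurableSet_subtriangle k))
    (fun k l hkl => (pairwise_disjoint_subtriangle hkl).mono Set.inter_subset_right
      Set.inter_subset_right)]
  have hst : MeasurableSet (s ∩ triangle) := hs.inter measurableSet_triangle
  simp_rw [preimage_inter_subtriangle, lintegral_image_projMap (isTriangleMatrix_branchMatrix _)
    hst Set.inter_subset_right]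
  rw [← lintegral_tsum]
  · refine setLIntegral_congr_fun hst fun p hp => ?_
    have hsum := hasSum_invDensity_transfer hp.2
    have hnn : ∀ k, 0 ≤ 1 / denom (branchMatrix k) p ^ 3 :=
      fun k => by
        have := (isTriangleMatrix_branchMatrix k).denom_pos hp.2
        positivity
    simp_rw [← ENNReal.ofReal_mul (hnn _)]
    rw [← ENNReal.ofReal_tsum_of_nonneg _ hsum.summable, hsum.tsum_eq]
    exact fun k => mul_nonneg (hnn k)
      (invDensity_pos ((isTriangleMatrix_branchMatrix k).mapsTo hp.2)).le
  · intro k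
    have h1 : Measurable fun p => denom (branchMatrix k) p := by unfold denom; fun_prop
    have h2 : Measurable fun p => projMap (branchMatrix k) p := by unfold projMap; fun_prop
    exact ((h1.pow_const 3).const_div 1).ennreal_ofReal.aemeasurable.mul
      (measurable_ofReal_invDensity.comp h2).aemeasurable

/-! ### Birkhoff's ergodic theorem, by the maximal function. -/

section Birkhoff

variable {α : Type*} {f : α → α} {g : α → ℝ}

/-- The maximum of `0` and the first `n` Birkhoff sums of `g`. -/
def birkhoffMax (f : α → α) (g : α → ℝ) : ℕ → α → ℝ
  | 0 => fun _ => 0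
  | n + 1 => fun x => max 0 (g x + birkhoffMax f g n (f x))

lemma birkhoffMax_succ (n : ℕ) (x : α) :
    birkhoffMax f g (n + 1) x = max 0 (g x + birkhoffMax f g n (f x)) := rfl

lemma birkhoffMax_nonneg (n : ℕ) (x : α) : 0 ≤ birkhoffMax f g n x := by
  cases n with
  | zero => exact le_rfl
  | succ n => exact le_max_left _ _

lemma birkhoffMax_le_succ (n : ℕ) (x : α) : birkhoffMax f g n x ≤ birkhoffMax f g (n + 1) x := by
  induction n generalizing x with
  | zero => exact birkhoffMax_nonneg 1 x
  | succ n ih => exact max_le_max le_rfl (by linarith [ih (f x)])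

lemma birkhoffSum_le_birkhoffMax (n : ℕ) (x : α) : birkhoffSum f g n x ≤ birkhoffMax f g n x := by
  induction n generalizing x with
  | zero => simp [birkhoffMax]
  | succ n ih =>
    rw [birkhoffSum_succ']
    exact le_max_of_le_right (by linarith [ih (f x)])

lemma preimage_setOf_not_bddAbove_birkhoffSum :
    f ⁻¹' {x | ¬ BddAbove (Set.range fun n => birkhoffSum f g n x)} =
      {x | ¬ BddAbove (Set.range fun n => birkhoffSum f g n x)} := by
  ext x
  simp only [Set.mem_preimage, Set.mem_ofPred_eq, not_iff_not]
  constructor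
  · rintro ⟨B, hB⟩
    refine ⟨max 0 (g x + B), ?_⟩
    rintro _ ⟨n, rfl⟩
    cases n with
    | zero => simp
    | succ n =>
      have := hB ⟨n, rfl⟩
      simp only at this
      simp only [birkhoffSum_succ']
      exact le_max_of_le_right (by linarith)
  · rintro ⟨B, hB⟩
    refine ⟨B - g x, ?_⟩
    rintro _ ⟨n, rfl⟩
    have := hB ⟨n + 1, rfl⟩
    simp only [birkhoffSum_succ'] at this
    simp only
    linarith

variable [MeasurableSpace α] {μ : Measure α}

lemma integrable_birkhoffMax (hf : MeasurePreserving f μ μ) (hg : Integrable g μ) (n : ℕ) :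
    Integrable (birkhoffMax f g n) μ := by
  induction n with
  | zero => exact integrable_zero _ _ _
  | succ n ih => exact (integrable_zero _ _ _).sup (hg.add (hf.integrable_comp_of_integrable ih))

lemma measurable_birkhoffSum (hf : Measurable f) (hg : Measurable g) (n : ℕ) :
    Measurable (birkhoffSum f g n) := by
  unfold birkhoffSum
  exact Finset.measurable_fun_sum _ fun k _ => hg.comp (hf.iterate k)

/-- A form of the maximal ergodic theorem. -/
lemma ae_bddAbove_birkhoffSum [IsProbabilityMeasure μ] (hf : Ergodic f μ) (hgm : Measurable g)
    (hg : Integrable g μ) (hneg : ∫ x, g x ∂μ < 0) :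
    ∀ᵐ x ∂μ, BddAbove (Set.range fun n => birkhoffSum f g n x) := by
  have hms : MeasurableSet {x | ¬ BddAbove (Set.range fun n => birkhoffSum f g n x)} :=
    (measurableSet_bddAbove_range fun n => measurable_birkhoffSum hf.measurable hgm n).compl
  rcases hf.ae_mem_or_ae_notMem hms preimage_setOf_not_bddAbove_birkhoffSum with h | h
  swap
  · filter_upwards [h] with x hx
    simpa using hx
  exfalso
  have hint := integrable_birkhoffMax hf.toMeasurePreserving hg
  have hint' : ∀ n, Integrable (fun x => birkhoffMax f g n (f x)) μ := fun n =>
    hf.toMeasurePreserving.integrable_comp_of_integrable (hint n)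
  -- Where the sums are unbounded, the maximum in `birkhoffMax_succ` is eventually its second entry,
  -- so the difference is eventually `g x`; it is always dominated by `|g x|`. By invariance of μ
  -- and monotonicity in n these integrals are nonnegative, contradicting `hneg`.
  have hlim : Tendsto (fun n => ∫ x, (birkhoffMax f g (n + 1) x - birkhoffMax f g n (f x)) ∂μ)
      atTop (𝓝 (∫ x, g x ∂μ)) := by
    refine tendsto_integral_of_dominated_convergence (fun x => |g x|)
      (fun n => ((hint (n + 1)).sub (hint' n)).aestronglyMeasurable) hg.abs
      (fun n => Eventually.of_forall fun x => ?_) ?_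
    · have h0 := birkhoffMax_nonneg (f := f) (g := g) n (f x)
      rw [birkhoffMax_succ, Real.norm_eq_abs]
      rcases max_cases 0 (g x + birkhoffMax f g n (f x)) with ⟨h1, h2⟩ | ⟨h1, h2⟩ <;> rw [h1]
      · rw [abs_le]
        constructor <;> linarith [neg_abs_le (g x), abs_nonneg (g x)]
      · rw [add_sub_cancel_right]
    · filter_upwards [h] with x hx
      have hfx : ¬ BddAbove (Set.range fun n => birkhoffSum f g n (f x)) := by
        have := preimage_setOf_not_bddAbove_birkhoffSum (f := f) (g := g)
        exact (Set.ext_iff.1 this x).2 hx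
      rw [not_bddAbove_iff] at hfx
      obtain ⟨_, ⟨N, rfl⟩, hN⟩ := hfx (-g x)
      refine tendsto_const_nhds.congr' ?_
      filter_upwards [eventually_ge_atTop N] with n hn
      have hmono := monotone_nat_of_le_succ (f := fun n => birkhoffMax f g n (f x))
        (fun n => birkhoffMax_le_succ n (f x)) hn
      have hle := birkhoffSum_le_birkhoffMax (f := f) (g := g) N (f x)
      simp only at hmono hN
      rw [birkhoffMax_succ, max_eq_right (by linarith)]
      ring
  refine absurd (ge_of_tendsto' hlim fun n => ?_) (not_le.2 hneg)
  rw [integral_sub (hint (n + 1)) (hint' n)]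
  have heq : ∫ x, birkhoffMax f g n (f x) ∂μ = ∫ x, birkhoffMax f g n x ∂μ := by
    have hmap := hf.toMeasurePreserving.map_eq
    conv_rhs => rw [← hmap]
    rw [integral_map hf.measurable.aemeasurable]
    rw [hmap]
    exact (hint n).aestronglyMeasurable
  rw [heq, sub_nonneg]
  exact integral_mono (hint n) (hint (n + 1)) fun x => birkhoffMax_le_succ n x

/-- For c strictly between the integral and b, the sums of g - c are bounded above by some B almost
everywhere, so the averages of g are at most c + B/n. -/
lemma ae_eventually_birkhoffAverage_lt [IsProbabilityMeasure μ] (hf : Ergodic f μ)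
    (hgm : Measurable g) (hg : Integrable g μ) {b : ℝ} (hb : ∫ x, g x ∂μ < b) :
    ∀ᵐ x ∂μ, ∀ᶠ n in atTop, birkhoffAverage ℝ f g n x < b := by
  obtain ⟨c, hc, hcb⟩ := exists_between hb
  have h := ae_bddAbove_birkhoffSum (g := fun x => g x - c) hf (hgm.sub_const c)
    (hg.sub (integrable_const c)) (by
      rw [integral_sub hg (integrable_const c)]
      simpa using hc)
  filter_upwards [h] with x ⟨B, hB⟩
  have hlim : Tendsto (fun n : ℕ => c + B * (n : ℝ)⁻¹) atTop (𝓝 (c + B * 0)) :=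
    (tendsto_inv_atTop_nhds_zero_nat.const_mul B).const_add c
  rw [mul_zero, add_zero] at hlim
  filter_upwards [hlim.eventually_lt_const hcb, eventually_gt_atTop 0] with n hn hn0
  refine lt_of_le_of_lt ?_ hn
  have h1 := hB ⟨n, rfl⟩
  have hn0' : (0 : ℝ) < n := by exact_mod_cast hn0
  have h2 : birkhoffSum f (fun x => g x - c) n x = birkhoffSum f g n x - n * c := by
    simp [birkhoffSum, Finset.sum_sub_distrib]
  simp only [h2] at h1
  rw [birkhoffAverage, smul_eq_mul]
  have h3 : birkhoffSum f g n x ≤ B + n * c := by linarith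
  calc (n : ℝ)⁻¹ * birkhoffSum f g n x ≤ (n : ℝ)⁻¹ * (B + n * c) := by gcongr
    _ = c + B * (n : ℝ)⁻¹ := by field_simp; ring

/-- **Birkhoff's ergodic theorem** for an ergodic probability measure. -/
theorem ae_tendsto_birkhoffAverage [IsProbabilityMeasure μ] (hf : Ergodic f μ)
    (hgm : Measurable g) (hg : Integrable g μ) :
    ∀ᵐ x ∂μ, Tendsto (fun n => birkhoffAverage ℝ f g n x) atTop (𝓝 (∫ x, g x ∂μ)) := by
  have h1 : ∀ᵐ x ∂μ, ∀ m : ℕ, ∀ᶠ n in atTop,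
      birkhoffAverage ℝ f g n x < ∫ x, g x ∂μ + 1 / ((m : ℝ) + 1) :=
    ae_all_iff.2 fun m => ae_eventually_birkhoffAverage_lt hf hgm hg (by
      have : (0 : ℝ) < 1 / ((m : ℝ) + 1) := by positivity
      linarith)
  have h2 : ∀ᵐ x ∂μ, ∀ m : ℕ, ∀ᶠ n in atTop,
      birkhoffAverage ℝ f (-g) n x < -∫ x, g x ∂μ + 1 / ((m : ℝ) + 1) :=
    ae_all_iff.2 fun m => ae_eventually_birkhoffAverage_lt hf hgm.neg hg.neg (by
      have : (0 : ℝ) < 1 / ((m : ℝ) + 1) := by positivity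
      simp only [Pi.neg_apply]
      rw [integral_neg]
      linarith)
  filter_upwards [h1, h2] with x h1 h2
  rw [tendsto_order]
  constructor
  · intro a ha
    obtain ⟨m, hm⟩ := exists_nat_one_div_lt (sub_pos.2 ha)
    filter_upwards [h2 m] with n hn
    rw [birkhoffAverage_neg] at hn
    simp only [Pi.neg_apply] at hn
    linarith
  · intro a ha
    obtain ⟨m, hm⟩ := exists_nat_one_div_lt (sub_pos.2 ha)
    filter_upwards [h1 m] with n hn
    linarith

end Birkhoff

/-! ### Total mass of the invariant measure and mass of `△_0`. -/

lemma setLIntegral_prod_section {s : Set (ℝ × ℝ)} (hs : MeasurableSet s) {g : ℝ × ℝ → ENNReal}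
    (hg : Measurable g) :
    ∫⁻ p in s, g p = ∫⁻ x, ∫⁻ y in Prod.mk x ⁻¹' s, g (x, y) := by
  rw [← lintegral_indicator hs, Measure.volume_eq_prod,
    lintegral_prod _ (hg.indicator hs).aemeasurable]
  refine lintegral_congr fun x => ?_
  rw [← lintegral_indicator (measurable_prodMk_left hs)]
  rfl

lemma setIntegral_prod_section {s : Set (ℝ × ℝ)} (hs : MeasurableSet s) {g : ℝ × ℝ → ℝ}
    (hg : IntegrableOn g s) :
    ∫ p in s, g p = ∫ x, ∫ y in Prod.mk x ⁻¹' s, g (x, y) := by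
  rw [← integral_indicator hs, Measure.volume_eq_prod, integral_prod]
  · refine integral_congr_ae (Eventually.of_forall fun x => ?_)
    simp only
    rw [← integral_indicator (measurable_prodMk_left hs)]
    rfl
  · rw [← Measure.volume_eq_prod]
    exact (integrable_indicator_iff hs).2 hg

lemma setLIntegral_Ioo_ofReal {f : ℝ → ℝ} {a b : ℝ} (hab : a ≤ b) (hf : Continuous f)
    (h0 : ∀ y ∈ Set.Ioo a b, 0 ≤ f y) :
    ∫⁻ y in Set.Ioo a b, ENNReal.ofReal (f y) = ENNReal.ofReal (∫ y in a..b, f y) := by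
  rw [intervalIntegral.integral_of_le hab, integral_Ioc_eq_integral_Ioo,
    ofReal_integral_eq_lintegral_ofReal]
  · exact (hf.integrableOn_Icc (a := a) (b := b)).mono_set Set.Ioo_subset_Icc_self
  · exact (ae_restrict_iff' measurableSet_Ioo).2 (Eventually.of_forall h0)

lemma setLIntegral_triangle {g : ℝ × ℝ → ENNReal} (hg : Measurable g) :
    ∫⁻ p in triangle, g p = ∫⁻ x in Set.Ioo (0 : ℝ) 1, ∫⁻ y in Set.Ioo 0 x, g (x, y) := by
  rw [setLIntegral_prod_section measurableSet_triangle hg,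
    ← lintegral_indicator measurableSet_Ioo]
  refine lintegral_congr fun x => ?_
  by_cases hx : x ∈ Set.Ioo (0 : ℝ) 1
  · rw [Set.indicator_of_mem hx]
    have : Prod.mk x ⁻¹' triangle = Set.Ioo 0 x := by
      ext y
      simp only [triangle, Set.mem_preimage, Set.mem_ofPred_eq, Set.mem_Ioo]
      exact ⟨fun h => ⟨h.1, h.2.1⟩, fun h => ⟨h.1, h.2, hx.2⟩⟩
    rw [this]
  · rw [Set.indicator_of_notMem hx]
    have : Prod.mk x ⁻¹' triangle = ∅ := by
      ext y
      simp only [triangle, Set.mem_preimage, Set.mem_ofPred_eq, Set.mem_empty_iff_false, iff_false]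
      exact fun h => hx ⟨h.1.trans h.2.1, h.2.2⟩
    rw [this]
    simp

lemma setLIntegral_triangle_monomial {c : ℝ} (hc : 0 ≤ c) (n : ℕ) :
    ∫⁻ p in triangle, ENNReal.ofReal (c / p.1 * p.2 ^ n) =
      ENNReal.ofReal (c * (1 / ((n : ℝ) + 1) ^ 2)) := by
  rw [setLIntegral_triangle (by fun_prop)]
  have hn : (n : ℝ) + 1 ≠ 0 := by positivity
  have h1 : ∀ x ∈ Set.Ioo (0 : ℝ) 1,
      ∫⁻ y in Set.Ioo 0 x, ENNReal.ofReal (c / x * y ^ n) =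
        ENNReal.ofReal (c / (n + 1) * x ^ n) := by
    intro x hx
    have hx0 := hx.1
    rw [setLIntegral_Ioo_ofReal hx.1.le (by fun_prop)
      (fun y hy => by have := hy.1; positivity)]
    congr 1
    rw [intervalIntegral.integral_const_mul, integral_pow]
    field_simp
    ring
  rw [setLIntegral_congr_fun measurableSet_Ioo h1, setLIntegral_Ioo_ofReal zero_le_one (by fun_prop)
    (fun y hy => by have := hy.1; positivity)]
  congr 1
  rw [intervalIntegral.integral_const_mul, integral_pow]
  field_simp
  simp

/-- Expanding 1/(1-y) as a geometric series and integrating termwise gives (6/π²) Σ 1/(n+1)². -/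
lemma lintegral_invDensity :
    ∫⁻ p in triangle, ENNReal.ofReal (invDensity p) = 1 := by
  have hc : (0 : ℝ) ≤ 6 / Real.pi ^ 2 := by positivity
  have h : ∀ p ∈ triangle, ENNReal.ofReal (invDensity p) =
      ∑' n : ℕ, ENNReal.ofReal (6 / Real.pi ^ 2 / p.1 * p.2 ^ n) := by
    rintro p ⟨h1, h2, h3⟩
    have hx : 0 < p.1 := h1.trans h2
    have hs := (hasSum_geometric_of_lt_one h1.le (h2.trans h3)).mul_left (6 / Real.pi ^ 2 / p.1)
    rw [← ENNReal.ofReal_tsum_of_nonneg (fun n => by positivity) hs.summable, hs.tsum_eq]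
    congr 1
    have : 1 - p.2 ≠ 0 := by linarith
    rw [invDensity]
    field_simp
  rw [setLIntegral_congr_fun measurableSet_triangle h, lintegral_tsum (fun n => by fun_prop)]
  simp_rw [setLIntegral_triangle_monomial hc]
  have hz : HasSum (fun n : ℕ => 1 / ((n : ℝ) + 1) ^ 2) (Real.pi ^ 2 / 6) := by
    have := (hasSum_nat_add_iff' 1).2 hasSum_zeta_two
    simpa using this
  have hz' := hz.mul_left (6 / Real.pi ^ 2)
  rw [← ENNReal.ofReal_tsum_of_nonneg (fun n => by positivity) hz'.summable, hz'.tsum_eq]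
  have := Real.pi_pos.ne'
  rw [show 6 / Real.pi ^ 2 * (Real.pi ^ 2 / 6) = 1 by field_simp, ENNReal.ofReal_one]

instance isProbabilityMeasure_invMeasure : IsProbabilityMeasure invMeasure :=
  ⟨by rw [invMeasure_apply MeasurableSet.univ, Set.univ_inter, lintegral_invDensity]⟩

lemma integrableOn_invDensity : IntegrableOn invDensity triangle := by
  refine ⟨measurable_invDensity.aestronglyMeasurable, ?_⟩
  rw [hasFiniteIntegral_iff_ofReal]
  · rw [lintegral_invDensity]
    exact ENNReal.one_lt_top
  · exact (ae_restrict_iff' measurableSet_triangle).2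
      (Eventually.of_forall fun p hp => (invDensity_pos hp).le)

lemma invMeasure_real_eq {s : Set (ℝ × ℝ)} (hs : MeasurableSet s) (hst : s ⊆ triangle) :
    invMeasure.real s = ∫ p in s, invDensity p := by
  rw [integral_eq_lintegral_of_nonneg_ae, Measure.real, invMeasure_apply hs,
    Set.inter_eq_left.2 hst]
  · exact (ae_restrict_iff' hs).2 (Eventually.of_forall fun p hp => (invDensity_pos (hst hp)).le)
  · exact measurable_invDensity.aestronglyMeasurable

/-- The involution of the triangle that exchanges its vertices `(0, 0)` and `(1, 1)`. -/
def triangleFlip : (ℝ × ℝ) ≃ᵐ (ℝ × ℝ) :=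
  MeasurableEquiv.prodComm.trans
    ((MeasurableEquiv.subLeft (1 : ℝ)).prodCongr (MeasurableEquiv.subLeft (1 : ℝ)))

lemma triangleFlip_apply (p : ℝ × ℝ) : triangleFlip p = (1 - p.2, 1 - p.1) := rfl

lemma measurePreserving_triangleFlip : MeasurePreserving triangleFlip volume volume := by
  have h1 : MeasurePreserving (fun x : ℝ => 1 - x) volume volume :=
    Measure.measurePreserving_sub_left volume 1
  exact (h1.prod h1).comp Measure.measurePreserving_swap

/-- The line x + y = 1 cuts the triangle into `△_0` and its mirror image `L` under `triangleFlip`,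
which preserves both Lebesgue measure and the density. -/
lemma invMeasure_subtriangle_zero : invMeasure.real (subtriangle 0) = 1 / 2 := by
  have hU : MeasurableSet (⋃ k, subtriangle (k + 1)) :=
    MeasurableSet.iUnion fun k => measurableSet_subtriangle _
  have hflip : triangleFlip ⁻¹' {p | 0 < p.2 ∧ p.2 < p.1 ∧ p.1 + p.2 < 1} = subtriangle 0 := by
    ext p
    rw [mem_subtriangle]
    simp only [Set.mem_preimage, triangleFlip_apply, Set.mem_ofPred_eq]
    constructor
    · rintro ⟨h1, h2, h3⟩
      norm_num
      refine ⟨?_, ?_, ?_⟩ <;> linarith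
    · rintro ⟨h1, h2, h3⟩
      norm_num at h2 h3
      refine ⟨?_, ?_, ?_⟩ <;> linarith
  set L : Set (ℝ × ℝ) := {p | 0 < p.2 ∧ p.2 < p.1 ∧ p.1 + p.2 < 1} with hL
  have hLm : MeasurableSet L := by
    change MeasurableSet ({p : ℝ × ℝ | 0 < p.2} ∩ ({p | p.2 < p.1} ∩ {p | p.1 + p.2 < 1}))
    exact
    (measurableSet_lt (by fun_prop) (by fun_prop)).inter
      ((measurableSet_lt (by fun_prop) (by fun_prop)).inter
        (measurableSet_lt (by fun_prop) (by fun_prop)))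
  have hLt : L ⊆ triangle := fun p hp => ⟨hp.1, hp.2.1, by linarith [hp.1, hp.2.2]⟩
  have heq : invMeasure L = invMeasure (subtriangle 0) := by
    rw [invMeasure_apply hLm, invMeasure_apply (measurableSet_subtriangle 0),
      Set.inter_eq_left.2 hLt, Set.inter_eq_left.2 (subtriangle_subset_triangle 0), ← hflip,
      ← measurePreserving_triangleFlip.setLIntegral_comp_preimage hLm measurable_ofReal_invDensity]
    refine lintegral_congr fun p => ?_
    simp only [invDensity, triangleFlip_apply]
    congr 2
    ring
  have hdisj : Disjoint L (subtriangle 0) := by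
    rw [Set.disjoint_left]
    intro p hp hp0
    have := (mem_subtriangle.1 hp0).2.2
    norm_num at this
    linarith [hp.2.2]
  have hunion : invMeasure (L ∪ subtriangle 0) = 1 := by
    rw [← isProbabilityMeasure_invMeasure.measure_univ]
    refine measure_congr ?_
    have h0 : ∀ᵐ p : ℝ × ℝ, p.2 ≠ 1 - p.1 := by
      rw [ae_iff]
      simpa using volume_graph_eq_zero (f := fun x => 1 - x) (by fun_prop)
    have h1 : ∀ᵐ p ∂invMeasure, p ∈ L ∪ subtriangle 0 := by
      rw [ae_invMeasure_iff, ae_restrict_iff' measurableSet_triangle]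
      filter_upwards [h0] with p hp ⟨h1, h2, h3⟩
      rcases lt_or_gt_of_ne hp with h | h
      · exact Or.inl ⟨h1, h2, by linarith⟩
      · refine Or.inr (mem_subtriangle.2 ⟨h2, ?_, ?_⟩) <;> norm_num <;> linarith
    filter_upwards [h1] with p hp
    exact propext ⟨fun _ => trivial, fun _ => hp⟩
  rw [measure_union hdisj (measurableSet_subtriangle 0), heq, ← two_mul] at hunion
  have := congrArg ENNReal.toReal hunion
  rw [ENNReal.toReal_mul] at this
  simp at this
  rw [Measure.real]
  linarith

/-! ### Words, itineraries and cylinders. -/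

/-- The matrix of the inverse branch of an iterate of `T_{e,23,e}` with prescribed digits. -/
def wordMatrix (u : List ℕ) : Matrix (Fin 3) (Fin 3) ℝ := (u.map branchMatrix).prod

lemma wordMatrix_cons (k : ℕ) (u : List ℕ) :
    wordMatrix (k :: u) = branchMatrix k * wordMatrix u := by
  simp [wordMatrix]

lemma wordMatrix_append (u v : List ℕ) :
    wordMatrix (u ++ v) = wordMatrix u * wordMatrix v := by
  simp [wordMatrix]

lemma isTriangleMatrix_wordMatrix (u : List ℕ) : IsTriangleMatrix (wordMatrix u) := by
  induction u with
  | nil => exact isTriangleMatrix_one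
  | cons k u ih =>
    rw [wordMatrix_cons]
    exact (isTriangleMatrix_branchMatrix k).mul ih

lemma projMap_wordMatrix_cons (k : ℕ) (u : List ℕ) {p : ℝ × ℝ} (hp : p ∈ triangle) :
    projMap (wordMatrix (k :: u)) p = projMap (branchMatrix k) (projMap (wordMatrix u) p) := by
  rw [wordMatrix_cons, projMap_mul (isTriangleMatrix_branchMatrix k)
    (isTriangleMatrix_wordMatrix u) hp]

lemma projMap_wordMatrix_append (u v : List ℕ) {p : ℝ × ℝ} (hp : p ∈ triangle) :
    projMap (wordMatrix (u ++ v)) p = projMap (wordMatrix u) (projMap (wordMatrix v) p) := by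
  rw [wordMatrix_append, projMap_mul (isTriangleMatrix_wordMatrix u)
    (isTriangleMatrix_wordMatrix v) hp]

lemma triMap_iterate_projMap_wordMatrix (u : List ℕ) {p : ℝ × ℝ} (hp : p ∈ triangle) :
    triMap^[u.length] (projMap (wordMatrix u) p) = p := by
  induction u with
  | nil => simp [wordMatrix, projMap_one]
  | cons k u ih =>
    rw [List.length_cons, Function.iterate_succ_apply, projMap_wordMatrix_cons k u hp,
      triMap_projMap_branchMatrix k ((isTriangleMatrix_wordMatrix u).mapsTo hp), ih]

/-- The word of the first `n` digits of a point. -/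
def itinerary : ℕ → ℝ × ℝ → List ℕ
  | 0, _ => []
  | n + 1, p => firstDigit p :: itinerary n (triMap p)

lemma itinerary_add (m n : ℕ) (p : ℝ × ℝ) :
    itinerary (m + n) p = itinerary m p ++ itinerary n (triMap^[m] p) := by
  induction m generalizing p with
  | zero => simp [itinerary]
  | succ m ih =>
    rw [show m + 1 + n = m + n + 1 by ring, itinerary, ih, itinerary, List.cons_append,
      Function.iterate_succ_apply]

lemma itinerary_projMap_wordMatrix (u : List ℕ) {p : ℝ × ℝ} (hp : p ∈ triangle) :
    itinerary u.length (projMap (wordMatrix u) p) = u := by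
  induction u with
  | nil => rfl
  | cons k u ih =>
    have h := (isTriangleMatrix_wordMatrix u).mapsTo hp
    rw [List.length_cons, itinerary, projMap_wordMatrix_cons k u hp,
      triMap_projMap_branchMatrix k h, ih, firstDigit_eq (projMap_branchMatrix_mem h)]

/-- The points with an infinite expansion. -/
def regularPoints : Set (ℝ × ℝ) := {p | ∀ i, ∃ k, triMap^[i] p ∈ subtriangle k}

lemma triMap_mem_regularPoints {p : ℝ × ℝ} (hp : p ∈ regularPoints) :
    triMap p ∈ regularPoints := by
  intro i
  rw [← Function.iterate_succ_apply]
  exact hp (i + 1)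

lemma mem_triangle_of_mem_regularPoints {p : ℝ × ℝ} (hp : p ∈ regularPoints) (n : ℕ) :
    triMap^[n] p ∈ triangle := by
  obtain ⟨k, hk⟩ := hp n
  exact subtriangle_subset_triangle k hk

lemma projMap_itinerary {p : ℝ × ℝ} (hp : p ∈ regularPoints) (n : ℕ) :
    projMap (wordMatrix (itinerary n p)) (triMap^[n] p) = p := by
  induction n generalizing p with
  | zero => simp [itinerary, wordMatrix, projMap_one]
  | succ n ih =>
    have h := triMap_mem_regularPoints hp
    obtain ⟨k, hk⟩ := hp 0
    rw [Function.iterate_zero_apply] at hk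
    rw [itinerary, projMap_wordMatrix_cons _ _ (mem_triangle_of_mem_regularPoints hp _),
      Function.iterate_succ_apply, ih h, firstDigit_eq hk, projMap_branchMatrix_triMap hk]

lemma ae_mem_regularPoints : ∀ᵐ p ∂invMeasure, p ∈ regularPoints := by
  have h : ∀ᵐ p ∂invMeasure, ∃ k, p ∈ subtriangle k := by
    rw [ae_invMeasure_iff, ae_restrict_iff' measurableSet_triangle]
    exact ae_mem_subtriangle
  exact ae_all_iff.2 fun i => (measurePreserving_triMap.iterate i).quasiMeasurePreserving.ae h

/-- The set of the points of the triangle whose expansion begins with a given word. -/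
def cylinder (u : List ℕ) : Set (ℝ × ℝ) := projMap (wordMatrix u) '' triangle

lemma cylinder_subset_triangle (u : List ℕ) : cylinder u ⊆ triangle :=
  (isTriangleMatrix_wordMatrix u).mapsTo.image_subset

lemma measurableSet_cylinder (u : List ℕ) : MeasurableSet (cylinder u) :=
  measurableSet_image_projMap (isTriangleMatrix_wordMatrix u) measurableSet_triangle subset_rfl

lemma cylinder_append (u v : List ℕ) :
    cylinder (u ++ v) = projMap (wordMatrix u) '' cylinder v := by
  rw [cylinder, cylinder, Set.image_image]
  exact Set.image_congr fun _ hp => projMap_wordMatrix_append u v hp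

lemma itinerary_eq_of_mem_cylinder {u : List ℕ} {p : ℝ × ℝ} (hp : p ∈ cylinder u) :
    itinerary u.length p = u := by
  obtain ⟨q, hq, rfl⟩ := hp
  exact itinerary_projMap_wordMatrix u hq

/-- Both words are initial segments of the itinerary of `p`, so the longer one extends the shorter.
-/
lemma cylinder_subset_cylinder {u v : List ℕ} {p : ℝ × ℝ} (hu : p ∈ cylinder u)
    (hv : p ∈ cylinder v) (h : u.length ≤ v.length) : cylinder v ⊆ cylinder u := by
  obtain ⟨n, hn⟩ := Nat.exists_eq_add_of_le h
  have h1 := itinerary_eq_of_mem_cylinder hv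
  rw [hn, itinerary_add, itinerary_eq_of_mem_cylinder hu] at h1
  rw [← h1, cylinder_append]
  exact Set.image_mono (cylinder_subset_triangle _)

/-! ### Distortion and contraction on the core triangle. -/

/-- A cylinder that is compactly contained in the triangle. -/
def coreTriangle : Set (ℝ × ℝ) := cylinder [1, 1, 1]

lemma wordMatrix_core : wordMatrix [1, 1, 1] = !![4, 5, -3; 3, 1, -1; 1, 2, -1] := by
  have h : branchMatrix 1 = !![1, 2, -1; 1, 0, 0; 0, 1, 0] := by
    rw [branchMatrix]
    norm_num
  simp only [wordMatrix, List.map_cons, List.map_nil, List.prod_cons, List.prod_nil, mul_one, h,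
    Matrix.mul_fin_three]
  norm_num

lemma denom_wordMatrix_core (p : ℝ × ℝ) :
    denom (wordMatrix [1, 1, 1]) p = 4 + 5 * p.1 - 3 * p.2 := by
  rw [wordMatrix_core]
  simp [denom]
  ring

/-- The three quantities are the barycentric coordinates in the triangle. The core has vertices
(3/4, 1/4), (4/9, 1/3), (1/2, 1/3), and the smallest coordinate occurring is x - y = 1/9 at the
second. -/
lemma coreTriangle_bounds {p : ℝ × ℝ} (hp : p ∈ coreTriangle) :
    1 / 9 ≤ p.2 ∧ 1 / 9 ≤ p.1 - p.2 ∧ 1 / 9 ≤ 1 - p.1 := by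
  obtain ⟨q, hq, rfl⟩ := hp
  have hd := (isTriangleMatrix_wordMatrix [1, 1, 1]).denom_pos hq
  obtain ⟨h1, h2, h3⟩ := hq
  rw [projMap, denom_wordMatrix_core]
  rw [denom_wordMatrix_core] at hd
  simp only [wordMatrix_core, Matrix.of_apply, Matrix.cons_val]
  refine ⟨?_, ?_, ?_⟩
  · rw [le_div_iff₀ hd]; linarith
  · rw [← sub_div, le_div_iff₀ hd]; linarith
  · rw [one_sub_div hd.ne', le_div_iff₀ hd]; linarith

lemma coreTriangle_subset : coreTriangle ⊆ triangle := cylinder_subset_triangle _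

/-- Barycentric coordinates of `q` are below 1, so subtracting a ninth of them from those of `p`
leaves positive numbers. Since denominators are affine, this yields the distortion bound 9. -/
lemma exists_eq_combination_of_mem_coreTriangle {p q : ℝ × ℝ} (hp : p ∈ coreTriangle)
    (hq : q ∈ triangle) : ∃ r ∈ triangle, p = (1 / 9 : ℝ) • q + (8 / 9 : ℝ) • r := by
  obtain ⟨h1, h2, h3⟩ := coreTriangle_bounds hp
  obtain ⟨k1, k2, k3⟩ := hq
  refine ⟨((9 * p.1 - q.1) / 8, (9 * p.2 - q.2) / 8), ⟨?_, ?_, ?_⟩, ?_⟩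
  · simp only; linarith
  · simp only; linarith
  · simp only; linarith
  · ext <;> simp <;> ring

lemma denom_combination (M : Matrix (Fin 3) (Fin 3) ℝ) (p q : ℝ × ℝ) :
    denom M ((1 / 9 : ℝ) • p + (8 / 9 : ℝ) • q) = 1 / 9 * denom M p + 8 / 9 * denom M q := by
  simp [denom]
  ring

lemma denom_le_of_mem_coreTriangle {M : Matrix (Fin 3) (Fin 3) ℝ} (hM : IsTriangleMatrix M)
    {p q : ℝ × ℝ} (hp : p ∈ coreTriangle) (hq : q ∈ triangle) : denom M q ≤ 9 * denom M p := by
  obtain ⟨r, hr, rfl⟩ := exists_eq_combination_of_mem_coreTriangle hp hq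
  rw [denom_combination]
  linarith [hM.denom_pos hr]

lemma dist_projMap_le_of_mem_coreTriangle {M : Matrix (Fin 3) (Fin 3) ℝ}
    (hM : IsTriangleMatrix M) {δ : ℝ}
    (hδ : ∀ p ∈ triangle, ∀ q ∈ triangle, dist (projMap M p) (projMap M q) ≤ δ)
    {p q : ℝ × ℝ} (hp : p ∈ coreTriangle) (hq : q ∈ coreTriangle) :
    dist (projMap M p) (projMap M q) ≤ 72 / 73 * δ := by
  have hqt := coreTriangle_subset hq
  obtain ⟨r, hr, hpr⟩ := exists_eq_combination_of_mem_coreTriangle hp hqt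
  have hle := denom_le_of_mem_coreTriangle hM hq hr
  have dq := hM.denom_pos hqt
  have dr := hM.denom_pos hr
  have dp : denom M p = 1 / 9 * denom M q + 8 / 9 * denom M r := by
    rw [hpr, denom_combination]
  have dp0 : 0 < denom M p := by rw [dp]; positivity
  -- A projective map sends a convex combination to one with weights rescaled by the denominators.
  -- The weight of `r` becomes 8d_r/(d_q + 8d_r), which is at most 8/(1/9 + 8) = 72/73 because d_r ≤
  -- 9d_q.
  have key : projMap M p - projMap M q =
      (8 / 9 * denom M r / denom M p) • (projMap M r - projMap M q) := by
    have e1 : p.1 = 1 / 9 * q.1 + 8 / 9 * r.1 := by rw [hpr]; simp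
    have e2 : p.2 = 1 / 9 * q.2 + 8 / 9 * r.2 := by rw [hpr]; simp
    have e3 : denom M q = 9 * denom M p - 8 * denom M r := by rw [dp]; ring
    have aux : ∀ a b c : ℝ, (a + b * p.1 + c * p.2) / denom M p -
        (a + b * q.1 + c * q.2) / denom M q = (8 / 9 * denom M r / denom M p) *
        ((a + b * r.1 + c * r.2) / denom M r - (a + b * q.1 + c * q.2) / denom M q) := by
      intro a b c
      have : a + b * p.1 + c * p.2 =
          1 / 9 * (a + b * q.1 + c * q.2) + 8 / 9 * (a + b * r.1 + c * r.2) := by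
        rw [e1, e2]; ring
      rw [this]
      generalize a + b * q.1 + c * q.2 = A
      generalize a + b * r.1 + c * r.2 = B
      have h9 : 9 * denom M p = denom M q + 8 * denom M r := by rw [dp]; ring
      field_simp
      linear_combination (-A) * h9
    ext
    · exact aux _ _ _
    · exact aux _ _ _
  rw [dist_eq_norm, key, norm_smul, ← dist_eq_norm, Real.norm_of_nonneg (by positivity)]
  refine mul_le_mul ?_ (hδ r hr q hqt) dist_nonneg (by norm_num)
  rw [div_le_iff₀ dp0, dp]
  linarith

lemma dist_le_one_of_mem_triangle {p q : ℝ × ℝ} (hp : p ∈ triangle) (hq : q ∈ triangle) :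
    dist p q ≤ 1 := by
  obtain ⟨h1, h2, h3⟩ := hp
  obtain ⟨k1, k2, k3⟩ := hq
  rw [Prod.dist_eq, Real.dist_eq, Real.dist_eq, max_le_iff, abs_le, abs_le]
  refine ⟨⟨?_, ?_⟩, ?_, ?_⟩ <;> linarith

lemma exists_itinerary_contracting {p : ℝ × ℝ}
    (hfreq : ∃ᶠ n in atTop, triMap^[n] p ∈ coreTriangle) (m : ℕ) :
    ∃ n, triMap^[n] p ∈ coreTriangle ∧ ∀ x ∈ triangle, ∀ y ∈ triangle,
      dist (projMap (wordMatrix (itinerary n p)) x) (projMap (wordMatrix (itinerary n p)) y) ≤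
        (72 / 73) ^ m := by
  induction m with
  | zero =>
    obtain ⟨n, hn⟩ := hfreq.exists
    refine ⟨n, hn, fun x hx y hy => ?_⟩
    have hM := isTriangleMatrix_wordMatrix (itinerary n p)
    rw [pow_zero]
    exact dist_le_one_of_mem_triangle (hM.mapsTo hx) (hM.mapsTo hy)
  | succ m ih =>
    obtain ⟨n, hn, hd⟩ := ih
    -- Waiting three steps places the whole block 1, 1, 1 read at time `n` inside the new itinerary,
    -- so its tail maps the triangle into the core before the old branch acts.
    obtain ⟨l, hl, hlc⟩ := (frequently_atTop.1 hfreq) (n + 3)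
    refine ⟨l, hlc, ?_⟩
    obtain ⟨j, rfl⟩ := Nat.exists_eq_add_of_le hl
    have hcore : itinerary 3 (triMap^[n] p) = [1, 1, 1] := itinerary_eq_of_mem_cylinder hn
    have hit : itinerary (n + 3 + j) p =
        itinerary n p ++ ([1, 1, 1] ++ itinerary j (triMap^[n + 3] p)) := by
      rw [itinerary_add, itinerary_add, hcore, List.append_assoc]
    rw [hit]
    have hmem : ∀ x ∈ triangle,
        projMap (wordMatrix ([1, 1, 1] ++ itinerary j (triMap^[n + 3] p))) x ∈ coreTriangle := by
      intro x hx
      rw [projMap_wordMatrix_append _ _ hx]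
      exact Set.mem_image_of_mem _ ((isTriangleMatrix_wordMatrix _).mapsTo hx)
    intro x hx y hy
    rw [projMap_wordMatrix_append _ _ hx, projMap_wordMatrix_append _ _ hy, pow_succ']
    exact dist_projMap_le_of_mem_coreTriangle (isTriangleMatrix_wordMatrix _) hd (hmem x hx)
      (hmem y hy)

lemma exists_cylinder_subset_of_isOpen {U : Set (ℝ × ℝ)} (hU : IsOpen U) {p : ℝ × ℝ}
    (hpU : p ∈ U) (hp : p ∈ regularPoints)
    (hfreq : ∃ᶠ n in atTop, triMap^[n] p ∈ coreTriangle) :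
    ∃ v, p ∈ cylinder (v ++ [1, 1, 1]) ∧ cylinder (v ++ [1, 1, 1]) ⊆ U := by
  obtain ⟨ε, hε, hball⟩ := Metric.isOpen_iff.1 hU p hpU
  obtain ⟨m, hm⟩ := exists_pow_lt_of_lt_one hε (by norm_num : (72 / 73 : ℝ) < 1)
  obtain ⟨n, hn, hd⟩ := exists_itinerary_contracting hfreq m
  refine ⟨itinerary n p, ?_, ?_⟩
  · rw [cylinder_append]
    exact ⟨_, hn, projMap_itinerary hp n⟩
  · rw [cylinder_append]
    rintro _ ⟨x, hx, rfl⟩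
    refine hball ?_
    rw [Metric.mem_ball]
    have h := hd x (coreTriangle_subset hx) _ (coreTriangle_subset hn)
    rw [projMap_itinerary hp n] at h
    exact h.trans_lt hm

/-! ### Recurrence to the core and ergodicity. -/

lemma ae_frequently_mem_coreTriangle : ∀ᵐ p : ℝ × ℝ, p ∈ coreTriangle →
    p ∈ regularPoints ∧ ∃ᶠ n in atTop, triMap^[n] p ∈ coreTriangle := by
  have h1 := measurePreserving_triMap.conservative.ae_mem_imp_frequently_image_mem
    (measurableSet_cylinder [1, 1, 1]).nullMeasurableSet
  have h2 := h1.and ae_mem_regularPoints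
  rw [ae_invMeasure_iff, ae_restrict_iff' measurableSet_triangle] at h2
  filter_upwards [h2] with p hp hpc
  obtain ⟨h3, h4⟩ := hp (coreTriangle_subset hpc)
  exact ⟨h4, h3 hpc⟩

/-- A measure inequality that holds on the cylinders which end with the core word extends to open
sets. -/
lemma mul_volume_inter_coreTriangle_le {ν : Measure (ℝ × ℝ)} {a b : ENNReal}
    (h : ∀ v, a * volume (cylinder (v ++ [1, 1, 1])) ≤ b * ν (cylinder (v ++ [1, 1, 1])))
    {U : Set (ℝ × ℝ)} (hU : IsOpen U) : a * volume (U ∩ coreTriangle) ≤ b * ν U := by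
  set C : List ℕ → Set (ℝ × ℝ) := fun v => cylinder (v ++ [1, 1, 1]) with hC
  -- The maximal cylinders of the family inside `U`. They are disjoint because cylinders are nested
  -- or disjoint, and they cover almost all of `U ∩ coreTriangle`: a recurrent point lies in a
  -- shortest admissible cylinder.
  set S : Set (List ℕ) := {v | C v ⊆ U ∧ ∀ v', C v' ⊆ U → v'.length < v.length →
    Disjoint (C v) (C v')} with hS
  have hcount : S.Countable := Set.to_countable S
  have hdisj : S.PairwiseDisjoint C := by
    intro v hv v' hv' hne
    rcases lt_trichotomy v.length v'.length with hl | hl | hl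
    · exact (hv'.2 v hv.1 hl).symm
    · rw [Function.onFun, Set.disjoint_left]
      intro p hp hp'
      have h1 := itinerary_eq_of_mem_cylinder hp
      have h2 := itinerary_eq_of_mem_cylinder hp'
      rw [List.length_append, hl, ← List.length_append, h2] at h1
      exact hne (List.append_cancel_right h1).symm
    · exact hv.2 v' hv'.1 hl
  have hm : ∀ v ∈ S, MeasurableSet (C v) := fun v _ => measurableSet_cylinder _
  have hsub : (U ∩ coreTriangle : Set (ℝ × ℝ)) ≤ᵐ[volume] ⋃ v ∈ S, C v := by
    filter_upwards [ae_frequently_mem_coreTriangle] with p hp ⟨hpU, hpc⟩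
    obtain ⟨hreg, hfreq⟩ := hp hpc
    have hex : ∃ n, ∃ v : List ℕ, v.length = n ∧ p ∈ C v ∧ C v ⊆ U := by
      obtain ⟨v, hv⟩ := exists_cylinder_subset_of_isOpen hU hpU hreg hfreq
      exact ⟨_, v, rfl, hv⟩
    classical
    obtain ⟨v, hlen, hpv, hvU⟩ := Nat.find_spec hex
    refine Set.mem_biUnion (x := v) ⟨hvU, fun v' hv' hlt => ?_⟩ hpv
    rw [Set.disjoint_left]
    intro q hq hq'
    have hss : C v ⊆ C v' := cylinder_subset_cylinder hq' hq (by
      simp only [List.length_append]; omega)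
    exact Nat.find_min hex (hlen ▸ hlt) ⟨v', rfl, hss hpv, hv'⟩
  calc a * volume (U ∩ coreTriangle) ≤ a * volume (⋃ v ∈ S, C v) := by
        gcongr a * ?_
        exact measure_mono_ae hsub
    _ = ∑' v : S, a * volume (C v) := by
        rw [measure_biUnion hcount hdisj hm, ENNReal.tsum_mul_left]
    _ ≤ ∑' v : S, b * ν (C v) := ENNReal.tsum_le_tsum fun v => h v
    _ = b * ν (⋃ v ∈ S, C v) := by
        rw [measure_biUnion hcount hdisj hm, ENNReal.tsum_mul_left]
    _ ≤ b * ν U := by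
        gcongr
        exact Set.iUnion₂_subset fun v hv => hv.1

lemma mem_iff_iterate_mem {s : Set (ℝ × ℝ)} (hs : triMap ⁻¹' s = s) (n : ℕ) (p : ℝ × ℝ) :
    triMap^[n] p ∈ s ↔ p ∈ s := by
  induction n generalizing p with
  | zero => rfl
  | succ n ih =>
    rw [Function.iterate_succ_apply, ih]
    exact Set.ext_iff.1 hs p

lemma image_inter_of_preimage_eq {s : Set (ℝ × ℝ)} (hs : triMap ⁻¹' s = s) (u : List ℕ)
    {A : Set (ℝ × ℝ)} (hA : A ⊆ triangle) :
    projMap (wordMatrix u) '' (s ∩ A) = s ∩ projMap (wordMatrix u) '' A := by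
  have key : ∀ q ∈ A, (projMap (wordMatrix u) q ∈ s ↔ q ∈ s) := fun q hq => by
    rw [← mem_iff_iterate_mem hs u.length, triMap_iterate_projMap_wordMatrix u (hA hq)]
  ext p
  constructor
  · rintro ⟨q, ⟨hqs, hqA⟩, rfl⟩
    exact ⟨(key q hqA).2 hqs, q, hqA, rfl⟩
  · rintro ⟨hps, q, hqA, rfl⟩
    exact ⟨q, ⟨(key q hqA).1 hps, hqA⟩, rfl⟩

/-- Bounded distortion of the inverse branches on the core triangle. -/
lemma volume_inter_mul_le {s : Set (ℝ × ℝ)} (hsm : MeasurableSet s) (hs : triMap ⁻¹' s = s)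
    (v : List ℕ) :
    volume (s ∩ coreTriangle) * volume (cylinder (v ++ [1, 1, 1])) ≤
      (9 ^ 6 * volume coreTriangle) * volume (s ∩ cylinder (v ++ [1, 1, 1])) := by
  have hM := isTriangleMatrix_wordMatrix v
  have hcm : MeasurableSet coreTriangle := measurableSet_cylinder _
  rcases Set.eq_empty_or_nonempty coreTriangle with he | ⟨p₀, hp₀⟩
  · simp [he]
  have d0 := hM.denom_pos (coreTriangle_subset hp₀)
  set d := denom (wordMatrix v) p₀
  rw [cylinder_append]
  change volume (s ∩ coreTriangle) * volume (projMap (wordMatrix v) '' coreTriangle) ≤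
      (9 ^ 6 * volume coreTriangle) * volume (s ∩ projMap (wordMatrix v) '' coreTriangle)
  rw [← image_inter_of_preimage_eq hs v coreTriangle_subset,
    volume_image_projMap hM hcm coreTriangle_subset,
    volume_image_projMap hM (hsm.inter hcm) (Set.inter_subset_right.trans coreTriangle_subset)]
  have hup : ∫⁻ p in coreTriangle, ENNReal.ofReal (1 / denom (wordMatrix v) p ^ 3) ≤
      ENNReal.ofReal (1 / (d / 9) ^ 3) * volume coreTriangle := by
    rw [← setLIntegral_const]
    refine setLIntegral_mono measurable_const fun p hp => ?_
    have h1 := denom_le_of_mem_coreTriangle hM hp (coreTriangle_subset hp₀)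
    gcongr
    linarith
  have hlow : ENNReal.ofReal (1 / (9 * d) ^ 3) * volume (s ∩ coreTriangle) ≤
      ∫⁻ p in s ∩ coreTriangle, ENNReal.ofReal (1 / denom (wordMatrix v) p ^ 3) := by
    rw [← setLIntegral_const]
    refine setLIntegral_mono' (hsm.inter hcm) fun p hp => ?_
    have h1 := denom_le_of_mem_coreTriangle hM hp₀ (coreTriangle_subset hp.2)
    have h2 := hM.denom_pos (coreTriangle_subset hp.2)
    gcongr
  -- Denominators on the core lie between d/9 and 9d, so Jacobians differ by at most 81³ = 9⁶.
  have hc : ENNReal.ofReal (1 / (d / 9) ^ 3) = 9 ^ 6 * ENNReal.ofReal (1 / (9 * d) ^ 3) := by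
    rw [show (9 : ENNReal) ^ 6 = ENNReal.ofReal (9 ^ 6) by
      rw [ENNReal.ofReal_pow (by norm_num)]; norm_num, ← ENNReal.ofReal_mul (by positivity)]
    congr 1
    field_simp
  calc volume (s ∩ coreTriangle) *
        ∫⁻ p in coreTriangle, ENNReal.ofReal (1 / denom (wordMatrix v) p ^ 3)
      ≤ volume (s ∩ coreTriangle) *
        (9 ^ 6 * ENNReal.ofReal (1 / (9 * d) ^ 3) * volume coreTriangle) := by
        rw [← hc]; gcongr
    _ = (9 ^ 6 * volume coreTriangle) *
        (ENNReal.ofReal (1 / (9 * d) ^ 3) * volume (s ∩ coreTriangle)) := by ring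
    _ ≤ _ := by gcongr

lemma volume_triangle_lt_top : volume triangle < ⊤ := by
  have : triangle ⊆ Metric.ball (0 : ℝ × ℝ) 2 := by
    rintro p ⟨h1, h2, h3⟩
    rw [Metric.mem_ball, Prod.dist_eq, max_lt_iff, Real.dist_eq, Real.dist_eq, abs_lt, abs_lt]
    simp only [Prod.fst_zero, Prod.snd_zero]
    refine ⟨⟨?_, ?_⟩, ?_, ?_⟩ <;> linarith
  exact (measure_mono this).trans_lt measure_ball_lt_top

/-- Take an open `U` barely larger than the part of the core outside `s`. Bounded distortion gives
`s` a fixed proportion of each cylinder in `U`, hence vol(s ∩ core) · vol(core \ s) is at most a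
constant times vol(U ∩ s), which is arbitrarily small. -/
lemma volume_coreTriangle_diff_eq_zero {s : Set (ℝ × ℝ)} (hsm : MeasurableSet s)
    (hs : triMap ⁻¹' s = s) (h0 : volume (s ∩ coreTriangle) ≠ 0) :
    volume (coreTriangle \ s) = 0 := by
  have hcm : MeasurableSet coreTriangle := measurableSet_cylinder _
  have htop : volume coreTriangle ≠ ⊤ :=
    ((measure_mono coreTriangle_subset).trans_lt volume_triangle_lt_top).ne
  have hdm : MeasurableSet (coreTriangle \ s) := hcm.diff hsm
  have hdtop : volume (coreTriangle \ s) ≠ ⊤ :=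
    ((measure_mono Set.sdiff_subset).trans_lt htop.lt_top).ne
  have hb : (9 ^ 6 * volume coreTriangle : ENNReal) ≠ ⊤ :=
    ENNReal.mul_ne_top (by norm_num) htop
  have key : ∀ ε : ENNReal, ε ≠ 0 → volume (s ∩ coreTriangle) * volume (coreTriangle \ s) ≤
      (9 ^ 6 * volume coreTriangle) * ε := by
    intro ε hε
    obtain ⟨U, hsub, hU, -, hUε⟩ := hdm.exists_isOpen_sdiff_lt hdtop hε
    have h1 := mul_volume_inter_coreTriangle_le (ν := volume.restrict s)
      (a := volume (s ∩ coreTriangle)) (b := 9 ^ 6 * volume coreTriangle) (fun v => by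
        rw [Measure.restrict_apply (measurableSet_cylinder _), Set.inter_comm _ s]
        exact volume_inter_mul_le hsm hs v) hU
    rw [Measure.restrict_apply hU.measurableSet] at h1
    calc volume (s ∩ coreTriangle) * volume (coreTriangle \ s)
        ≤ volume (s ∩ coreTriangle) * volume (U ∩ coreTriangle) := by
          gcongr
          exact Set.subset_inter hsub Set.sdiff_subset
      _ ≤ _ := h1
      _ ≤ (9 ^ 6 * volume coreTriangle) * volume (U \ (coreTriangle \ s)) := by
          gcongr
          exact fun p hp => ⟨hp.1, fun h => h.2 hp.2⟩
      _ ≤ _ := by gcongr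
  have hzero : volume (s ∩ coreTriangle) * volume (coreTriangle \ s) = 0 := by
    by_contra hne
    have hlim : Tendsto (fun ε : ENNReal => (9 ^ 6 * volume coreTriangle) * ε) (𝓝[≠] 0) (𝓝 0) := by
      have := ENNReal.Tendsto.const_mul (a := 9 ^ 6 * volume coreTriangle)
        (tendsto_id (x := 𝓝 (0 : ENNReal))) (Or.inr hb)
      rw [mul_zero] at this
      exact this.mono_left nhdsWithin_le_nhds
    have h2 := ge_of_tendsto hlim (eventually_nhdsWithin_of_forall fun ε hε => key ε hε)
    exact hne (le_antisymm h2 bot_le)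
  exact (mul_eq_zero.1 hzero).resolve_left h0

/-- The core is the image of the whole triangle under one inverse branch, which carries `s ∩
triangle` to `s ∩ coreTriangle` and has Jacobian at least 9⁻³. -/
lemma volume_triangle_inter_eq_zero {s : Set (ℝ × ℝ)} (hsm : MeasurableSet s)
    (hs : triMap ⁻¹' s = s) (h0 : volume (s ∩ coreTriangle) = 0) : volume (s ∩ triangle) = 0 := by
  have hM := isTriangleMatrix_wordMatrix [1, 1, 1]
  have hm : MeasurableSet (s ∩ triangle) := hsm.inter measurableSet_triangle
  have h1 : volume (projMap (wordMatrix [1, 1, 1]) '' (s ∩ triangle)) = 0 := by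
    rw [image_inter_of_preimage_eq hs _ subset_rfl]
    exact h0
  rw [volume_image_projMap hM hm Set.inter_subset_right] at h1
  have hlow : ENNReal.ofReal (1 / 9 ^ 3) * volume (s ∩ triangle) ≤ 0 := by
    rw [← h1, ← setLIntegral_const]
    refine setLIntegral_mono' hm fun p hp => ?_
    have h2 := hM.denom_pos hp.2
    obtain ⟨k1, k2, k3⟩ := hp.2
    have h3 : denom (wordMatrix [1, 1, 1]) p ≤ 9 := by
      rw [denom_wordMatrix_core]
      linarith
    gcongr
  have h4 := le_antisymm hlow bot_le
  rw [mul_eq_zero] at h4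
  refine h4.resolve_left ?_
  simp

lemma invMeasure_eq_zero {s : Set (ℝ × ℝ)} (hsm : MeasurableSet s)
    (h : volume (s ∩ triangle) = 0) : invMeasure s = 0 := by
  rw [invMeasure_apply hsm]
  exact setLIntegral_measure_zero _ _ h

theorem ergodic_triMap : Ergodic triMap invMeasure where
  toMeasurePreserving := measurePreserving_triMap
  aeconst_set s hsm hs := by
    rw [eventuallyConst_set']
    by_cases h0 : volume (s ∩ coreTriangle) = 0
    · left
      exact ae_eq_empty.2 (invMeasure_eq_zero hsm (volume_triangle_inter_eq_zero hsm hs h0))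
    · right
      have hsc : triMap ⁻¹' sᶜ = sᶜ := by rw [Set.preimage_compl, hs]
      rw [ae_eq_univ]
      refine invMeasure_eq_zero hsm.compl (volume_triangle_inter_eq_zero hsm.compl hsc ?_)
      rw [Set.inter_comm, ← Set.sdiff_eq]
      exact volume_coreTriangle_diff_eq_zero hsm hs h0

/-! ### Digit frequencies and the iterated integrals. -/

theorem digitFrequencyIs_measure (k : ℕ) :
    DigitFrequencyIs 1 (Equiv.swap 1 2) 1 k (invMeasure.real (subtriangle k)) := by
  have hm := measurableSet_subtriangle k
  have h := (ae_tendsto_birkhoffAverage ergodic_triMap (measurable_one.indicator hm)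
    ((integrable_const (1 : ℝ)).indicator hm)).and ae_mem_regularPoints
  rw [ae_invMeasure_iff] at h
  filter_upwards [h] with p ⟨hlim, hreg⟩
  have hmem : ∀ i, triMap^[i] p ∈ subtriangle (firstDigit (triMap^[i] p)) := fun i => by
    obtain ⟨l, hl⟩ := hreg i
    rwa [firstDigit_eq hl]
  refine ⟨hmem, ?_⟩
  rw [integral_indicator_one hm] at hlim
  refine hlim.congr fun n => ?_
  have hdig : ∀ i, (subtriangle k).indicator (1 : ℝ × ℝ → ℝ) (triMap^[i] p) =
      if digits 1 (Equiv.swap 1 2) 1 p i = k then 1 else 0 := by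
    intro i
    by_cases hi : digits 1 (Equiv.swap 1 2) 1 p i = k
    · rw [if_pos hi, Set.indicator_of_mem]
      · rfl
      · rw [← hi]; exact hmem i
    · rw [if_neg hi, Set.indicator_of_notMem]
      exact fun hk => hi (firstDigit_eq hk)
  rw [birkhoffAverage, birkhoffSum, frequency, Finset.sum_congr rfl fun i _ => hdig i,
    Finset.sum_boole, smul_eq_mul, inv_mul_eq_div]

lemma setIntegral_eq_of_sections {s : Set (ℝ × ℝ)} (hs : MeasurableSet s) {g : ℝ × ℝ → ℝ}
    (hg : IntegrableOn g s) {α β : ℝ} (hαβ : α ≤ β) {a b : ℝ → ℝ}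
    (hab : ∀ x ∈ Set.Ioc α β, a x ≤ b x)
    (hsec : ∀ x y, (x, y) ∈ s ↔ x ∈ Set.Ioc α β ∧ y ∈ Set.Ioo (a x) (b x)) :
    ∫ p in s, g p = ∫ x in α..β, ∫ y in (a x)..(b x), g (x, y) := by
  rw [setIntegral_prod_section hs hg, intervalIntegral.integral_of_le hαβ,
    ← integral_indicator measurableSet_Ioc]
  refine integral_congr_ae (Eventually.of_forall fun x => ?_)
  simp only
  by_cases hx : x ∈ Set.Ioc α β
  · rw [Set.indicator_of_mem hx, intervalIntegral.integral_of_le (hab x hx),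
      integral_Ioc_eq_integral_Ioo]
    have : Prod.mk x ⁻¹' s = Set.Ioo (a x) (b x) := by
      ext y
      rw [Set.mem_preimage, hsec]
      exact and_iff_right hx
    rw [this]
  · rw [Set.indicator_of_notMem hx]
    have : Prod.mk x ⁻¹' s = ∅ := by
      ext y
      rw [Set.mem_preimage, hsec]
      exact iff_of_false (fun h => hx h.1) (Set.notMem_empty y)
    rw [this]
    simp

lemma integrableOn_subtriangle (k : ℕ) : IntegrableOn invDensity (subtriangle k) :=
  integrableOn_invDensity.mono_set (subtriangle_subset_triangle k)

/-- `△_k` has vertices (1, 0), (1/(k+2), 1/(k+2)), (1/(k+1), 1/(k+1)). Its lower side is x + (k+1)y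
= 1 throughout, while the upper boundary changes at x = 1/(k+1) from the diagonal to x + ky = 1;
hence the two integrals. -/
lemma setIntegral_subtriangle {k : ℕ} (hk : 0 < k) :
    ∫ p in subtriangle k, invDensity p =
      (∫ x in (1 / ((k : ℝ) + 2))..(1 / ((k : ℝ) + 1)),
          ∫ y in ((1 - x) / ((k : ℝ) + 1))..x, invDensity (x, y)) +
        ∫ x in (1 / ((k : ℝ) + 1))..1,
          ∫ y in ((1 - x) / ((k : ℝ) + 1))..((1 - x) / (k : ℝ)), invDensity (x, y) := by
  have hk0 : (0 : ℝ) < k := by exact_mod_cast hk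
  have hk1 : (0 : ℝ) < (k : ℝ) + 1 := by positivity
  have hk2 : (0 : ℝ) < (k : ℝ) + 2 := by positivity
  have hm := measurableSet_subtriangle k
  have hl : MeasurableSet {p : ℝ × ℝ | p.1 ≤ 1 / ((k : ℝ) + 1)} :=
    measurableSet_le (by fun_prop) (by fun_prop)
  have hint := integrableOn_subtriangle k
  rw [← integral_inter_add_sdiff hl hint]
  congr 1
  · refine setIntegral_eq_of_sections (hm.inter hl) (hint.mono_set Set.inter_subset_left)
      (one_div_le_one_div_of_le hk1 (by linarith)) ?_ ?_
    · rintro x ⟨h1, -⟩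
      rw [div_lt_iff₀ hk2] at h1
      rw [div_le_iff₀ hk1]
      linarith
    · intro x y
      simp only [Set.mem_inter_iff, mem_subtriangle, Set.mem_ofPred_eq, Set.mem_Ioc, Set.mem_Ioo]
      rw [div_lt_iff₀ hk2, div_lt_iff₀ hk1, le_div_iff₀ hk1]
      constructor
      · rintro ⟨⟨h1, h2, h3⟩, h4⟩
        refine ⟨⟨?_, h4⟩, by linarith, h1⟩
        nlinarith
      · rintro ⟨⟨h1, h2⟩, h3, h4⟩
        refine ⟨⟨h4, ?_, by linarith⟩, h2⟩
        nlinarith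
  · refine setIntegral_eq_of_sections (hm.diff hl) (hint.mono_set Set.sdiff_subset)
      ((div_le_one hk1).2 (by linarith)) ?_ ?_
    · rintro x ⟨-, h2⟩
      exact div_le_div_of_nonneg_left (by linarith) hk0 (by linarith)
    · intro x y
      simp only [Set.mem_sdiff, mem_subtriangle, Set.mem_ofPred_eq, Set.mem_Ioc, Set.mem_Ioo, not_le]
      rw [div_lt_iff₀ hk1, div_lt_iff₀ hk1, lt_div_iff₀ hk0]
      constructor
      · rintro ⟨⟨h1, h2, h3⟩, h4⟩
        refine ⟨⟨h4, ?_⟩, by linarith, by linarith⟩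
        have : 0 < y := by linarith
        nlinarith
      · rintro ⟨⟨h1, h2⟩, h3, h4⟩
        refine ⟨⟨?_, by linarith, by linarith⟩, h1⟩
        nlinarith

end

end TRIP

theorem mainTheorem7 :
    TRIP.DigitFrequencyIs 1 (Equiv.swap 1 2) 1 0 (1 / 2) ∧
    ∀ k : ℕ, 0 < k →
      TRIP.DigitFrequencyIs 1 (Equiv.swap 1 2) 1 k
        ((∫ x in (1 / ((k : ℝ) + 2))..(1 / ((k : ℝ) + 1)),
            ∫ y in ((1 - x) / ((k : ℝ) + 1))..x, 6 / (Real.pi ^ 2 * x * (1 - y))) +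
          ∫ x in (1 / ((k : ℝ) + 1))..1,
            ∫ y in ((1 - x) / ((k : ℝ) + 1))..((1 - x) / (k : ℝ)),
              6 / (Real.pi ^ 2 * x * (1 - y))) ∧
      IntegrableOn (fun p : ℝ × ℝ => 6 / (Real.pi ^ 2 * p.1 * (1 - p.2)))
        (TRIP.cell 1 (Equiv.swap 1 2) 1 k) ∧
      ∫ p in TRIP.cell 1 (Equiv.swap 1 2) 1 k, 6 / (Real.pi ^ 2 * p.1 * (1 - p.2)) =
        (∫ x in (1 / ((k : ℝ) + 2))..(1 / ((k : ℝ) + 1)),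
            ∫ y in ((1 - x) / ((k : ℝ) + 1))..x, 6 / (Real.pi ^ 2 * x * (1 - y))) +
          ∫ x in (1 / ((k : ℝ) + 1))..1,
            ∫ y in ((1 - x) / ((k : ℝ) + 1))..((1 - x) / (k : ℝ)),
              6 / (Real.pi ^ 2 * x * (1 - y)) := by

  refine ⟨?_, fun k hk => ?_⟩
  · have h := TRIP.digitFrequencyIs_measure 0
    rwa [TRIP.invMeasure_subtriangle_zero] at h
  · have hint := TRIP.setIntegral_subtriangle hk
    refine ⟨?_, TRIP.integrableOn_subtriangle k, hint⟩
    have h := TRIP.digitFrequencyIs_measure k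
    rw [TRIP.invMeasure_real_eq (TRIP.measurableSet_subtriangle k)
      (TRIP.subtriangle_subset_triangle k), hint] at h
    exact h
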